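/- **Setting.** There are $K$ actions, a vector $\theta\in[0,D]^K$ (unknown to the learner), a number $\sigma>0$, and observation sets $S_1,\dots,S_K\subset\{1,\dots,K\}$ such that every $j$ lies in some $S_i$. In each round $t=1,2,\dots$ the learner chooses an action $i_t$ using only what happened in the previous rounds and possibly its own randomisation. If $i_t=i$, it observes for each $j\in S_i$ a variable $X_{t,i,j}\sim\mathcal N(\theta_j,\sigma^2)$, and it earns a payoff $Y_{t,i}$ with mean $\theta_i$. For fixed $t,i$ the variables $(X_{t,i,j})_{j\in S_i}$ are independent, and the observations and payoffs of round $t$ are independent of the past. The regret is $$R_T(\theta)=T\max_i\theta_i-\sum_{t=1}^T\mathbb E[Y_{t,i_t}].$$ **Linear program.** For $\lambda\in\mathbb R^K$ let $d_i(\lambda)=\max_j\lambda_j-\lambda_i$ and $d_{\max}(\lambda)=\max_i d_i(\lambda)$. If $\lambda$ has a unique maximal coordinate $i_1(\lambda)$, and $i_2(\lambda)$ is a second best action, let $$C_\lambda=\Big\{c\in[0,\infty)^K:\ \sum_{i:\,j\in S_i}c_i\ge\frac{2\sigma^2}{d_j(\lambda)^2}\ \ \forall j\ne i_1(\lambda),\quad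 \sum_{i:\,i_1(\lambda)\in S_i}c_i\ge\frac{2\sigma^2}{d_{i_2(\lambda)}(\lambda)^2}\Big\};$$ if the maximal coordinate is not unique, $C_\lambda=\emptyset$. Fix a function $c(\cdot)$ that assigns to every $\lambda$ with a unique maximal coordinate a minimiser $c(\lambda)$ of $\sum_i c_i d_i(\lambda)$ over $c\in C_\lambda$ which has the smallest $i_1(\lambda)$-coordinate among the minimisers. For $\epsilon>0$ let $$c_i(\theta,\epsilon)=\sup\{c_i(\theta'):\ |\theta'_j-\theta_j|\le\epsilon\ \ \forall j,\ \theta'\text{ has a unique maximal coordinate}\}\in[0,\infty].$$ **Algorithm 1** (inputs $S$, $\sigma$, $\alpha$, $\beta$). Before round $t$ let $N_i(t)$ be the number of plays of $i$, $n_i(t)$ the number of observations of $i$, and $\hat\theta_{i,t}$ the average of these observations. In round $t\le K$ play some $i_t$ with $t\in S_{i_t}$. Put $n_e(K+1)=0$. In round $t>K$: - if $N(t)/(4\alpha\log t)\in C_{\hat\theta_t}$, play $i_t=i_1(\hat\theta_t)$ and put $n_e(t+1)=n_e(t)$; - otherwise put $n_e(t+1)=n_e(t)+1$, and: if $\min_i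 n_i(t)<\beta(n_e(t))/K$, play some $i_t$ such that $S_{i_t}$ contains a minimiser of $i\mapsto n_i(t)$; if not, play some $i_t$ with $N_{i_t}(t)<4\alpha\, c_{i_t}(\hat\theta_t)\log t$ (any action if the maximal coordinate of $\hat\theta_t$ is not unique). Ties and free choices are resolved arbitrarily. **Theorem.** Let $\alpha>2$ and $\epsilon>0$, and let $\beta:[0,\infty)\to[0,\infty)$ be non-decreasing with $\beta(n)\le n/2$ and $\beta(m+n)\le\beta(m)+\beta(n)$ for all $m,n\in\mathbb N$. Then for every $\theta\in[0,D]^K$ and every $T\ge1$, any run of Algorithm 1 satisfies $$\begin{aligned}R_T(\theta)\le{}&\Big(2K+2+\frac{4K}{\alpha-2}\Big)d_{\max}(\theta)+4K\,d_{\max}(\theta)\sum_{s=0}^T\exp\Big(-\frac{\beta(s)\epsilon^2}{2K\sigma^2}\Big)\\&+2d_{\max}(\theta)\,\beta\Big(4\alpha\log T\sum_{i=1}^K c_i(\theta,\epsilon)+K\Big)+4\alpha\log T\sum_{i=1}^K c_i(\theta,\epsilon)\,d_i(\theta),\end{aligned}$$ where the right-hand side is computed in $[0,\infty]$ with $0\cdot\infty=0$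 and $\beta(\infty)=\sup\beta$. -/

import Mathlib

open MeasureTheory ProbabilityTheory
open scoped NNReal ENNReal

noncomputable section

namespace GraphBandit

variable {K : ℕ}

/-! ### Gaps and the linear program -/

/-- The gap `d_i(θ) = max_j θ_j - θ_i`. -/
def gap (θ : Fin K → ℝ) (i : Fin K) : ℝ := (⨆ j, θ j) - θ i

/-- `d_max(θ) = max_i d_i(θ)`. -/
def maxGap (θ : Fin K → ℝ) : ℝ := ⨆ i, gap θ i

/-- `i` is an optimal action for `θ`. -/
def IsBest (θ : Fin K → ℝ) (i : Fin K) : Prop := ∀ j, θ j ≤ θ i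

/-- `i` is the only optimal action for `θ`. -/
def IsUniqueBest (θ : Fin K → ℝ) (i : Fin K) : Prop := ∀ j, j ≠ i → θ j < θ i

/-- The gap of the second best action, when `b` is the only optimal action. -/
def secondGap (θ : Fin K → ℝ) (b : Fin K) : ℝ := ⨅ j : {j : Fin K // j ≠ b}, gap θ j

/-- The polyhedron `C_θ`. `S i` is the set of actions observed when `i` is played, and `σ ^ 2` is
the common variance of the observations. It is empty if `θ` has several optimal actions
(a right-hand side would then be `2 σ² / 0 = ∞`). -/
def feasible (S : Fin K → Finset (Fin K)) (σ : ℝ≥0) (θ : Fin K → ℝ) : Set (Fin K → ℝ) :=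
  {c | (∀ i, 0 ≤ c i) ∧ ∃ b, IsUniqueBest θ b ∧
    (∀ j, j ≠ b → 2 * (σ : ℝ) ^ 2 / gap θ j ^ 2 ≤ ∑ i with j ∈ S i, c i) ∧
    2 * (σ : ℝ) ^ 2 / secondGap θ b ^ 2 ≤ ∑ i with b ∈ S i, c i}

/-- `v` minimises `⟨c, d(θ)⟩` over `c ∈ C_θ` and, among the minimisers, has the smallest coordinate
at the optimal action. -/
structure IsLPSolution (S : Fin K → Finset (Fin K)) (σ : ℝ≥0) (θ v : Fin K → ℝ) : Prop where
  mem : v ∈ feasible S σ θ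
  min_cost : ∀ u ∈ feasible S σ θ, ∑ i, v i * gap θ i ≤ ∑ i, u i * gap θ i
  min_best : ∀ u ∈ feasible S σ θ, ∑ i, u i * gap θ i = ∑ i, v i * gap θ i →
    ∀ b, IsUniqueBest θ b → v b ≤ u b

/-- `c` selects a solution `c(θ)` of the linear program for every `θ` with a unique optimal
action. -/
def IsLPSelection (S : Fin K → Finset (Fin K)) (σ : ℝ≥0)
    (c : (Fin K → ℝ) → (Fin K → ℝ)) : Prop :=
  ∀ θ, (∃ b, IsUniqueBest θ b) → IsLPSolution S σ θ (c θ)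

/-- `c_i(θ, ε) = sup {c_i(θ') : |θ'_j - θ_j| ≤ ε for all j} ∈ [0, ∞]`, over the `θ'` for which
`c(θ')` is defined. -/
def cSup (c : (Fin K → ℝ) → (Fin K → ℝ)) (θ : Fin K → ℝ) (ε : ℝ) (i : Fin K) : ℝ≥0∞ :=
  ⨆ θ' ∈ {θ' : Fin K → ℝ | (∃ b, IsUniqueBest θ' b) ∧ ∀ j, |θ' j - θ j| ≤ ε},
    ENNReal.ofReal (c θ' i)

/-- The extension of a non-decreasing `β` to `[0, ∞]`, with `β(∞) = sup β`. -/
def extend (β : ℝ≥0 → ℝ≥0) (x : ℝ≥0∞) : ℝ≥0∞ :=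
  ⨆ (y : ℝ≥0) (_ : (y : ℝ≥0∞) ≤ x), (β y : ℝ≥0∞)

theorem extend_coe {β : ℝ≥0 → ℝ≥0} (hβ : Monotone β) (x : ℝ≥0) :
    extend β (x : ℝ≥0∞) = (β x : ℝ≥0∞) := by
  apply le_antisymm
  · refine iSup₂_le fun y hy => ?_
    exact_mod_cast hβ (ENNReal.coe_le_coe.1 hy)
  · exact le_iSup₂ (f := fun (y : ℝ≥0) (_ : (y : ℝ≥0∞) ≤ (x : ℝ≥0∞)) => (β y : ℝ≥0∞)) x le_rfl

/-! ### The algorithm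

`a t` is the action played in round `t = 1, 2, …`, and `x t j` is the observation of action `j`
obtained in round `t` if `j ∈ S (a t)`. -/

/-- `N_i(t)`: the number of plays of `i` before round `t`. -/
def numPlays (a : ℕ → Fin K) (i : Fin K) (t : ℕ) : ℕ :=
  ((Finset.Ico 1 t).filter fun s => a s = i).card

/-- `n_i(t)`: the number of observations of `i` before round `t`. -/
def numObs (S : Fin K → Finset (Fin K)) (a : ℕ → Fin K) (i : Fin K) (t : ℕ) : ℕ :=
  ((Finset.Ico 1 t).filter fun s => i ∈ S (a s)).card

/-- The empirical estimate of `θ` before round `t`. -/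
def empMean (S : Fin K → Finset (Fin K)) (a : ℕ → Fin K) (x : ℕ → Fin K → ℝ) (t : ℕ) :
    Fin K → ℝ :=
  fun i => (∑ s ∈ (Finset.Ico 1 t).filter (fun s => i ∈ S (a s)), x s i) / numObs S a i t

/-- The test `N(t) / (4 α log t) ∈ C_{θ̂_t}`. -/
def Exploits (S : Fin K → Finset (Fin K)) (σ : ℝ≥0) (α : ℝ) (a : ℕ → Fin K)
    (x : ℕ → Fin K → ℝ) (t : ℕ) : Prop :=
  (fun i => (numPlays a i t : ℝ) / (4 * α * Real.log t)) ∈ feasible S σ (empMean S a x t)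

open Classical in
/-- The exploration count `n_e(t)`, which starts with `n_e(K + 1) = 0`. -/
def explCount (S : Fin K → Finset (Fin K)) (σ : ℝ≥0) (α : ℝ) (a : ℕ → Fin K)
    (x : ℕ → Fin K → ℝ) : ℕ → ℕ
  | 0 => 0
  | t + 1 =>
    if K < t ∧ ¬ Exploits S σ α a x t then explCount S σ α a x t + 1
    else explCount S σ α a x t

/-- The test `min_i n_i(t) < β(n_e(t)) / K`. -/
def Forced (S : Fin K → Finset (Fin K)) (σ : ℝ≥0) (α : ℝ) (β : ℝ≥0 → ℝ≥0) (a : ℕ → Fin K)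
    (x : ℕ → Fin K → ℝ) (t : ℕ) : Prop :=
  ((⨅ i, numObs S a i t : ℕ) : ℝ) < (β (explCount S σ α a x t : ℝ≥0) : ℝ) / K

/-- The actions `a` follow the algorithm with inputs `S`, `σ`, `α`, `β` on the observations `x`,
ties and free choices being resolved arbitrarily. In the last case no constraint is imposed if
`c` is not defined at the empirical estimate (several empirically optimal actions). -/
structure FollowsAlgorithm (S : Fin K → Finset (Fin K)) (σ : ℝ≥0) (α : ℝ) (β : ℝ≥0 → ℝ≥0)
    (c : (Fin K → ℝ) → (Fin K → ℝ)) (a : ℕ → Fin K) (x : ℕ → Fin K → ℝ) : Prop where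
  /-- In rounds `1, …, K` the actions are observed one after the other. -/
  init : ∀ k : Fin K, k ∈ S (a ((k : ℕ) + 1))
  exploit : ∀ t, K < t → Exploits S σ α a x t → IsBest (empMean S a x t) (a t)
  forced : ∀ t, K < t → ¬ Exploits S σ α a x t → Forced S σ α β a x t →
    ∃ j, (∀ k, numObs S a j t ≤ numObs S a k t) ∧ j ∈ S (a t)
  explore : ∀ t, K < t → ¬ Exploits S σ α a x t → ¬ Forced S σ α β a x t →
    (∃ b, IsUniqueBest (empMean S a x t) b) →
      (numPlays a (a t) t : ℝ) < c (empMean S a x t) (a t) * (4 * α * Real.log t)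

/-! ### The environment -/

/-- A learner interacting with the environment `θ` in rounds `1, 2, …`. `X t i j` is the observation
of `j ∈ S i` if `i` is played in round `t` (the other entries of `X` are never used), `Y t i` is the
payoff of `i` in round `t`, and `I t` is the action played in round `t`. `F t` is the information
available after round `t`, which may include the learner's own randomisation. -/
structure IsInteraction {Ω : Type*} [mΩ : MeasurableSpace Ω] (P : Measure Ω)
    (S : Fin K → Finset (Fin K)) (σ : ℝ≥0) (θ : Fin K → ℝ) (F : Filtration ℕ mΩ)
    (X : ℕ → Fin K → Fin K → Ω → ℝ) (Y : ℕ → Fin K → Ω → ℝ) (I : ℕ → Ω → Fin K) : Prop where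
  /-- The action of a round is chosen before the round. -/
  action_meas : ∀ t, Measurable[F t] (I (t + 1))
  obs_meas : ∀ t i j, Measurable[F (t + 1)] (X (t + 1) i j)
  payoff_meas : ∀ t i, Measurable[F (t + 1)] (Y (t + 1) i)
  /-- The observations and payoffs of a round are independent of the past. -/
  indep_past : ∀ t, Indep (F t)
    (MeasurableSpace.comap
      (fun ω => ((fun i j => X (t + 1) i j ω, fun i => Y (t + 1) i ω) :
        (Fin K → Fin K → ℝ) × (Fin K → ℝ))) inferInstance) P
  obs_law : ∀ t i, ∀ j ∈ S i, P.map (X (t + 1) i j) = gaussianReal (θ j) (σ ^ 2)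
  obs_indep : ∀ t i, iIndepFun (fun (j : {j : Fin K // j ∈ S i}) => X (t + 1) i j) P
  /-- Of the law of the payoffs, only the mean matters. -/
  payoff_integrable : ∀ t i, Integrable (Y (t + 1) i) P
  payoff_mean : ∀ t i, ∫ ω, Y (t + 1) i ω ∂P = θ i

/-- The regret `R_T(θ) = T max_i θ_i - ∑_{t=1}^T E[Y_{t, i_t}]`. -/
def regret {Ω : Type*} [MeasurableSpace Ω] (P : Measure Ω) (θ : Fin K → ℝ)
    (Y : ℕ → Fin K → Ω → ℝ) (I : ℕ → Ω → Fin K) (T : ℕ) : ℝ :=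
  T * (⨆ i, θ i) - ∑ t ∈ Finset.Icc 1 T, ∫ ω, Y t (I t ω) ω ∂P

end GraphBandit

end

/-!
The regret is the expected sum of the gaps of the actions played (`ofReal_regret`), and the rounds
with a positive gap are of five kinds (`sum_gap_le`).

* The first `K` rounds.
* Exploitation rounds: feasibility of the plays makes every confidence radius at most half of an
  empirical gap, so while the confidence intervals hold the action played is optimal
  (`isBest_of_exploits`). The intervals fail in an expected number of rounds that is summable
  because `α > 2` (`lintegral_card_confFails_le`).
* Unforced exploration rounds with an estimate that is `ε`-accurate: then `c` at the estimate is at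
  most `c_i(θ, ε)`, so `i` is played at most `4 α log T c_i(θ, ε) + 1` times in such rounds
  (`card_accurateRounds_le`). Here the estimate must have a unique best action, which holds almost
  surely because Gaussian laws have no atoms (`ae_exists_isUniqueBest`).
* Unforced exploration rounds with an inaccurate estimate. In the exploration round with `n_e = s`
  all actions have been observed at least `β(s) / K` times unless the round is forced, so this has
  exponentially small probability (`lintegral_card_inaccurateRounds_le`).
* Forced exploration rounds. Their number `f` is at most `β(n_e)` (`card_forced_le`). With `A` and
  `B` the numbers of inaccurate and accurate unforced rounds, `n_e = f + A + B` and `β(n) ≤ n / 2`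
  give `n_e ≤ 2 (A + B)`, whence `f ≤ A + 2 β(B)` by subadditivity (`card_forced_le_add`).

Both probability bounds come from one Chernoff bound (`sum_measure_deviation_le`). The number of
observations is random and depends on the observations themselves; this is dealt with by the
exponential martingale `exp (∑ (l (x_s - θ_j) - l² σ² / 2))`, the sum being over the past
observations of `j`, evaluated on disjoint events that describe a stopping time.
-/

namespace GraphBandit

variable {K : ℕ}

/-! ### Gaps -/

theorem le_iSup_fin (θ : Fin K → ℝ) (i : Fin K) : θ i ≤ ⨆ j, θ j :=
  le_ciSup (Set.finite_range θ).bddAbove i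

theorem gap_nonneg (θ : Fin K → ℝ) (i : Fin K) : 0 ≤ gap θ i :=
  sub_nonneg.2 (le_iSup_fin θ i)

theorem gap_le_maxGap (θ : Fin K → ℝ) (i : Fin K) : gap θ i ≤ maxGap θ :=
  le_iSup_fin (gap θ) i

theorem maxGap_nonneg (θ : Fin K → ℝ) : 0 ≤ maxGap θ :=
  Real.iSup_nonneg (gap_nonneg θ)

theorem IsBest.iSup_eq {θ : Fin K → ℝ} {b : Fin K} (h : IsBest θ b) : ⨆ j, θ j = θ b :=
  have : Nonempty (Fin K) := ⟨b⟩
  le_antisymm (ciSup_le h) (le_iSup_fin θ b)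

theorem IsBest.gap_eq {θ : Fin K → ℝ} {b : Fin K} (h : IsBest θ b) (j : Fin K) :
    gap θ j = θ b - θ j := by rw [gap, h.iSup_eq]

theorem IsUniqueBest.isBest {θ : Fin K → ℝ} {b : Fin K} (h : IsUniqueBest θ b) : IsBest θ b :=
  fun j => by
    by_cases hj : j = b
    · rw [hj]
    · exact (h j hj).le

theorem IsUniqueBest.eq_of_isBest {θ : Fin K → ℝ} {b i : Fin K} (h : IsUniqueBest θ b)
    (hi : IsBest θ i) : i = b := by
  by_contra hne
  exact absurd (hi b) (not_le.2 (h i hne))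

theorem IsUniqueBest.secondGap_pos {θ : Fin K → ℝ} {b j : Fin K} (h : IsUniqueBest θ b)
    (hj : j ≠ b) : 0 < secondGap θ b := by
  have : Nonempty {j : Fin K // j ≠ b} := ⟨⟨j, hj⟩⟩
  obtain ⟨⟨i, hi⟩, hmin⟩ := exists_eq_ciInf_of_finite (f := fun j : {j : Fin K // j ≠ b} => gap θ j)
  rw [secondGap, ← hmin, h.isBest.gap_eq]
  exact sub_pos.2 (h i hi)

theorem secondGap_le (θ : Fin K → ℝ) {b j : Fin K} (hj : j ≠ b) : secondGap θ b ≤ gap θ j :=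
  ciInf_le (f := fun j : {j : Fin K // j ≠ b} => gap θ j) (Set.finite_range _).bddBelow ⟨j, hj⟩

/-- Distinct coordinates have a unique maximum. -/
theorem exists_isUniqueBest [Nonempty (Fin K)] {θ : Fin K → ℝ} (h : Function.Injective θ) :
    ∃ b, IsUniqueBest θ b := by
  obtain ⟨b, hb⟩ := Finite.exists_max θ
  exact ⟨b, fun j hj => lt_of_le_of_ne (hb j) fun e => hj (h e)⟩

/-! ### Counting plays and observations -/

variable {S : Fin K → Finset (Fin K)} {σ : ℝ≥0} {α : ℝ} {β : ℝ≥0 → ℝ≥0}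
  {c : (Fin K → ℝ) → (Fin K → ℝ)} {a : ℕ → Fin K} {x : ℕ → Fin K → ℝ}

theorem numObs_eq_sum (S : Fin K → Finset (Fin K)) (a : ℕ → Fin K) (j : Fin K) (t : ℕ) :
    numObs S a j t = ∑ i with j ∈ S i, numPlays a i t := by
  rw [numObs, Finset.card_eq_sum_card_fiberwise (f := a) (t := Finset.univ.filter fun i => j ∈ S i)
    (fun s hs => by simpa using (Finset.mem_filter.1 hs).2)]
  refine Finset.sum_congr rfl fun i hi => ?_
  rw [numPlays, Finset.filter_filter]
  congr 1
  ext s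
  simp only [Finset.mem_filter, Finset.mem_univ, true_and] at hi ⊢
  constructor
  · rintro ⟨h1, -, h2⟩
    exact ⟨h1, h2⟩
  · rintro ⟨h1, h2⟩
    exact ⟨h1, h2 ▸ hi, h2⟩

theorem numObs_lt (S : Fin K → Finset (Fin K)) (a : ℕ → Fin K) (j : Fin K) {t : ℕ} (ht : 0 < t) :
    numObs S a j t < t := by
  refine (Finset.card_filter_le _ _).trans_lt ?_
  rw [Nat.card_Ico]
  omega

/-- Playing an action that reveals `j` in round `s` increases the number of observations
of `j`. -/
theorem numObs_lt_of_mem {j : Fin K} {s t : ℕ} (hs : 1 ≤ s) (hst : s < t) (hj : j ∈ S (a s)) :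
    numObs S a j s < numObs S a j t := by
  refine Finset.card_lt_card ⟨fun r hr => ?_, fun h => ?_⟩
  · simp only [Finset.mem_filter, Finset.mem_Ico] at hr ⊢
    exact ⟨⟨hr.1.1, hr.1.2.trans hst⟩, hr.2⟩
  · have := h (Finset.mem_filter.2 ⟨Finset.mem_Ico.2 ⟨hs, hst⟩, hj⟩)
    simp at this

theorem FollowsAlgorithm.numObs_pos (h : FollowsAlgorithm S σ α β c a x) {t : ℕ} (ht : K < t)
    (j : Fin K) : 0 < numObs S a j t := by
  have h1 : (j : ℕ) + 1 < t := by have := j.2; omega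
  exact (Nat.zero_le _).trans_lt (numObs_lt_of_mem (by omega) h1 (h.init j))

theorem numObs_mul_empMean_sub (S : Fin K → Finset (Fin K)) (a : ℕ → Fin K) (x : ℕ → Fin K → ℝ)
    (j : Fin K) (t : ℕ) (m : ℝ) :
    numObs S a j t * (empMean S a x t j - m) =
      ∑ s ∈ Finset.Ico 1 t, if j ∈ S (a s) then x s j - m else 0 := by
  rw [← Finset.sum_filter, Finset.sum_sub_distrib, Finset.sum_const, nsmul_eq_mul, mul_sub]
  congr 1
  by_cases h : numObs S a j t = 0
  · rw [h, Finset.card_eq_zero.1 h]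
    simp
  · rw [empMean, mul_div_cancel₀ _ (by exact_mod_cast h)]

/-! ### Exploitation rounds -/

/-- The estimate of some `θ_j` before round `t`, based on at least one observation, is outside
the confidence interval of radius `√(2 α σ² log t / n_j(t))` around `θ_j`. -/
def ConfFails (S : Fin K → Finset (Fin K)) (σ : ℝ≥0) (α : ℝ) (θ : Fin K → ℝ) (a : ℕ → Fin K)
    (x : ℕ → Fin K → ℝ) (t : ℕ) : Prop :=
  ∃ j, 0 < numObs S a j t ∧
    √(2 * α * (σ : ℝ) ^ 2 * Real.log t / numObs S a j t) < |empMean S a x t j - θ j|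

/-- If the plays are feasible for the empirical gaps, then every confidence radius is at most half
of the empirical gap of `j`, so that the confidence intervals separate the empirically optimal
action from all others. -/
theorem isBest_of_exploits {θ : Fin K → ℝ} {t : ℕ} {i : Fin K} (hα : 0 < α) (ht : 2 ≤ t)
    (hn : ∀ j, 0 < numObs S a j t) (hex : Exploits S σ α a x t)
    (hconf : ¬ ConfFails S σ α θ a x t) (hi : IsBest (empMean S a x t) i) : IsBest θ i := by
  obtain ⟨-, b, hb, h1, h2⟩ := hex
  obtain rfl := hb.eq_of_isBest hi
  have hlog : 0 < Real.log t := Real.log_pos (by exact_mod_cast ht)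
  have hL : 0 < 4 * α * Real.log t := by positivity
  have hsum : ∀ j, ∑ k with j ∈ S k, (numPlays a k t : ℝ) / (4 * α * Real.log t) =
      numObs S a j t / (4 * α * Real.log t) := fun j => by
    rw [numObs_eq_sum, ← Finset.sum_div, Nat.cast_sum]
  -- If `n_j(t)` satisfies the constraint of the linear program for the gap `d`, then the confidence
  -- radius is at most `d / 2`.
  have key : ∀ j (d : ℝ), 0 < d →
      2 * (σ : ℝ) ^ 2 / d ^ 2 ≤ numObs S a j t / (4 * α * Real.log t) →
      |empMean S a x t j - θ j| ≤ d / 2 := by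
    intro j d hd h
    have hle : |empMean S a x t j - θ j| ≤
        √(2 * α * (σ : ℝ) ^ 2 * Real.log t / numObs S a j t) := by
      by_contra hlt
      exact hconf ⟨j, hn j, not_le.1 hlt⟩
    refine hle.trans (Real.sqrt_le_iff.2 ⟨by positivity, ?_⟩)
    have hnj : (0 : ℝ) < numObs S a j t := by exact_mod_cast hn j
    rw [div_le_div_iff₀ (by positivity) hL] at h
    rw [div_le_iff₀ hnj]
    nlinarith
  intro j
  by_cases hj : j = i
  · rw [hj]
  have hgap : gap (empMean S a x t) j = empMean S a x t i - empMean S a x t j :=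
    hi.gap_eq j
  have hpos : 0 < gap (empMean S a x t) j := by
    rw [hgap]
    exact sub_pos.2 (hb j hj)
  have e1 := key j _ hpos ((h1 j hj).trans_eq (hsum j))
  have e2 := key i _ (hb.secondGap_pos hj) (h2.trans_eq (hsum i))
  have e3 := secondGap_le (empMean S a x t) hj
  rw [abs_le] at e1 e2
  linarith [e1.1, e1.2, e2.1, e2.2]

/-! ### Exploration rounds -/

theorem explCount_succ_of_not_exploits {t : ℕ} (ht : K < t) (h : ¬ Exploits S σ α a x t) :
    explCount S σ α a x (t + 1) = explCount S σ α a x t + 1 := by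
  rw [explCount, if_pos ⟨ht, h⟩]

theorem explCount_mono (S : Fin K → Finset (Fin K)) (σ : ℝ≥0) (α : ℝ) (a : ℕ → Fin K)
    (x : ℕ → Fin K → ℝ) : Monotone (explCount S σ α a x) := by
  refine monotone_nat_of_le_succ fun t => ?_
  rw [explCount]
  split_ifs <;> omega

theorem explCount_le (S : Fin K → Finset (Fin K)) (σ : ℝ≥0) (α : ℝ) (a : ℕ → Fin K)
    (x : ℕ → Fin K → ℝ) (t : ℕ) : explCount S σ α a x t ≤ t := by
  induction t with
  | zero => exact le_rfl
  | succ t ih =>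
    rw [explCount]
    split_ifs <;> omega

open scoped Classical in
theorem explCount_succ_eq_card (S : Fin K → Finset (Fin K)) (σ : ℝ≥0) (α : ℝ) (a : ℕ → Fin K)
    (x : ℕ → Fin K → ℝ) (t : ℕ) :
    explCount S σ α a x (t + 1) =
      ((Finset.range (t + 1)).filter fun s => K < s ∧ ¬ Exploits S σ α a x s).card := by
  induction t with
  | zero => simp [explCount, Finset.filter_singleton]
  | succ t ih =>
    rw [explCount, Finset.range_add_one, Finset.filter_insert, ih]
    split_ifs with h
    · rw [Finset.card_insert_of_notMem (by simp)]
    · rfl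

open scoped Classical in
/-- Forced exploration rounds are at most `β(n_e)` in number: such a round increases the number of
observations of an action from some value in `[1, β(n_e) / K)`, and for every action each value is
left only once. -/
theorem card_forced_le (hβ : Monotone β) (h : FollowsAlgorithm S σ α β c a x) (T : ℕ) :
    (((Finset.range (T + 1)).filter fun t =>
      K < t ∧ ¬ Exploits S σ α a x t ∧ Forced S σ α β a x t).card : ℝ) ≤
      β (explCount S σ α a x (T + 1)) := by
  set G := (Finset.range (T + 1)).filter fun t =>
      K < t ∧ ¬ Exploits S σ α a x t ∧ Forced S σ α β a x t
  set y : ℝ := (β (explCount S σ α a x (T + 1)) : ℝ)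
  have hK : 0 < K := Fin.pos (a 0)
  have : Nonempty (Fin K) := ⟨a 0⟩
  have hG : ∀ t ∈ G, ∃ j, j ∈ S (a t) ∧ (numObs S a j t : ℝ) < y / K := by
    intro t ht
    obtain ⟨hT, hKt, hex, hf⟩ := by simpa [G] using ht
    obtain ⟨j, hj, hjS⟩ := h.forced t hKt hex hf
    refine ⟨j, hjS, ?_⟩
    have h1 : numObs S a j t ≤ ⨅ i, numObs S a i t := le_ciInf hj
    refine lt_of_le_of_lt (by exact_mod_cast h1) (hf.trans_le ?_)
    gcongr
    exact_mod_cast hβ (by exact_mod_cast explCount_mono S σ α a x (by omega))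
  choose! j hjS hjlt using hG
  have hcard : G.card ≤ ((Finset.univ : Finset (Fin K)) ×ˢ Finset.Ico 1 ⌈y / K⌉₊).card := by
    refine Finset.card_le_card_of_injOn (fun t => (j t, numObs S a (j t) t)) ?_ ?_
    · intro t ht
      have hKt : K < t := (Finset.mem_filter.1 ht).2.1
      have := h.numObs_pos hKt (j t)
      simpa using ⟨by omega, Nat.lt_ceil.2 (hjlt t ht)⟩
    · have hne : ∀ s ∈ G, ∀ t, s < t → j s = j t →
          numObs S a (j s) s ≠ numObs S a (j t) t := by
        intro s hs t hst hj
        have hKs : K < s := (Finset.mem_filter.1 hs).2.1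
        rw [← hj]
        exact (numObs_lt_of_mem (by omega) hst (hjS s hs)).ne
      intro s hs t ht hst
      obtain ⟨h1, h2⟩ := Prod.mk.inj hst
      rcases lt_trichotomy s t with hlt | rfl | hlt
      · exact absurd h2 (hne s hs t hlt h1)
      · rfl
      · exact absurd h2.symm (hne t ht s hlt h1.symm)
  rw [Finset.card_product, Finset.card_univ, Fintype.card_fin, Nat.card_Ico] at hcard
  have hyK : 0 ≤ y / K := by positivity
  have hceil : ((⌈y / K⌉₊ - 1 : ℕ) : ℝ) ≤ y / K := by
    rcases Nat.eq_zero_or_pos ⌈y / K⌉₊ with h0 | h0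
    · simpa [h0] using hyK
    · rw [Nat.cast_pred h0]
      linarith [Nat.ceil_lt_add_one hyK]
  calc (G.card : ℝ) ≤ (K * (⌈y / K⌉₊ - 1) : ℕ) := by exact_mod_cast hcard
    _ = K * ((⌈y / K⌉₊ - 1 : ℕ) : ℝ) := by push_cast; ring
    _ ≤ K * (y / K) := by gcongr
    _ = y := by field_simp

open scoped Classical in
/-- The rounds up to `T` in which the learner explores, without being forced to, on the basis of
an `ε`-accurate estimate. -/
noncomputable def accurateRounds (S : Fin K → Finset (Fin K)) (σ : ℝ≥0) (α : ℝ) (β : ℝ≥0 → ℝ≥0)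
    (θ : Fin K → ℝ) (ε : ℝ) (a : ℕ → Fin K) (x : ℕ → Fin K → ℝ) (T : ℕ) : Finset ℕ :=
  (Finset.range (T + 1)).filter fun t => K < t ∧ ¬ Exploits S σ α a x t ∧
    ¬ Forced S σ α β a x t ∧ ∀ j, |empMean S a x t j - θ j| ≤ ε

open scoped Classical in
/-- The rounds up to `T` in which the learner explores, without being forced to, on the basis of
an estimate which is not `ε`-accurate. -/
noncomputable def inaccurateRounds (S : Fin K → Finset (Fin K)) (σ : ℝ≥0) (α : ℝ) (β : ℝ≥0 → ℝ≥0)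
    (θ : Fin K → ℝ) (ε : ℝ) (a : ℕ → Fin K) (x : ℕ → Fin K → ℝ) (T : ℕ) : Finset ℕ :=
  (Finset.range (T + 1)).filter fun t => K < t ∧ ¬ Exploits S σ α a x t ∧
    ¬ Forced S σ α β a x t ∧ ∃ j, ε < |empMean S a x t j - θ j|

open scoped Classical in
/-- In these rounds the algorithm plays `i` only as long as `N_i(t) < 4 α c_i log t`, where `c_i` is
at most `c_i(θ, ε)`. -/
theorem card_accurateRounds_le {θ : Fin K → ℝ} {ε : ℝ} {T : ℕ} (hα : 0 < α)
    (h : FollowsAlgorithm S σ α β c a x)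
    (huniq : ∀ t, K < t → t ≤ T → ∃ b, IsUniqueBest (empMean S a x t) b) (i : Fin K) :
    ((((accurateRounds S σ α β θ ε a x T).filter fun t => a t = i).card : ℕ) : ℝ≥0∞) ≤
      ENNReal.ofReal (4 * α * Real.log T) * cSup c θ ε i + 1 := by
  set G := (accurateRounds S σ α β θ ε a x T).filter fun t => a t = i
  rcases G.eq_empty_or_nonempty with hG | hG
  · simp [hG]
  -- The last of these rounds is preceded by all others, which are plays of `i`.
  set t := G.max' hG
  obtain ⟨ht, hti⟩ := Finset.mem_filter.1 (G.max'_mem hG)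
  obtain ⟨htT, hKt, hex, hf, hnear⟩ := Finset.mem_filter.1 ht
  rw [Finset.mem_range] at htT
  change a t = i at hti
  have hcard : G.card ≤ numPlays a i t + 1 := by
    rw [← Finset.card_erase_add_one (G.max'_mem hG)]
    refine Nat.add_le_add_right (Finset.card_le_card fun s hs => ?_) 1
    obtain ⟨hst, hs⟩ := Finset.mem_erase.1 hs
    have hlt : s < t := lt_of_le_of_ne (G.le_max' s hs) hst
    obtain ⟨hs1, hs2⟩ := Finset.mem_filter.1 hs
    have hKs : K < s := (Finset.mem_filter.1 hs1).2.1
    exact Finset.mem_filter.2 ⟨Finset.mem_Ico.2 ⟨by omega, hlt⟩, hs2⟩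
  have hu := huniq t hKt (by omega)
  have hplay := h.explore t hKt hex hf hu
  rw [hti] at hplay
  have ht0 : (0 : ℝ) < t := by exact_mod_cast (by omega : 0 < t)
  have htT' : (t : ℝ) ≤ T := by exact_mod_cast (by omega : t ≤ T)
  have hlog : 0 ≤ Real.log t := Real.log_natCast_nonneg t
  calc ((G.card : ℕ) : ℝ≥0∞) ≤ (numPlays a i t : ℝ≥0∞) + 1 := by exact_mod_cast hcard
    _ ≤ ENNReal.ofReal (4 * α * Real.log T) * cSup c θ ε i + 1 := by
      gcongr
      rw [← ENNReal.ofReal_natCast]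
      refine (ENNReal.ofReal_le_ofReal hplay.le).trans ?_
      rw [ENNReal.ofReal_mul' (by positivity), mul_comm]
      gcongr
      exact le_iSup₂ (f := fun (θ' : Fin K → ℝ) (_ : θ' ∈ {θ' : Fin K → ℝ |
        (∃ b, IsUniqueBest θ' b) ∧ ∀ j, |θ' j - θ j| ≤ ε}) => ENNReal.ofReal (c θ' i))
        (empMean S a x t) ⟨hu, hnear⟩

open scoped Classical in
/-- The number of forced exploration rounds, bounded without reference to itself: half of all
exploration rounds at most are forced, and `β` is subadditive. -/
theorem card_forced_le_add (hβ : Monotone β) (hβ_half : ∀ n : ℕ, β n ≤ n / 2)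
    (hβ_sub : ∀ m n : ℕ, β (m + n) ≤ β m + β n)
    {θ : Fin K → ℝ} {ε : ℝ} (h : FollowsAlgorithm S σ α β c a x) (T : ℕ) :
    (((Finset.range (T + 1)).filter fun t =>
      K < t ∧ ¬ Exploits S σ α a x t ∧ Forced S σ α β a x t).card : ℝ) ≤
      (inaccurateRounds S σ α β θ ε a x T).card +
        2 * β (accurateRounds S σ α β θ ε a x T).card := by
  have h1 := card_forced_le hβ h T
  have hsplit : explCount S σ α a x (T + 1) = ((Finset.range (T + 1)).filter fun t =>
      K < t ∧ ¬ Exploits S σ α a x t ∧ Forced S σ α β a x t).card +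
      ((inaccurateRounds S σ α β θ ε a x T).card + (accurateRounds S σ α β θ ε a x T).card) := by
    rw [explCount_succ_eq_card, ← Finset.card_filter_add_card_filter_not (Forced S σ α β a x),
      Finset.filter_filter, Finset.filter_filter]
    congr 1
    · simp only [and_assoc]
    · rw [← Finset.card_filter_add_card_filter_not fun t => ∃ j, ε < |empMean S a x t j - θ j|,
        Finset.filter_filter, Finset.filter_filter]
      simp only [inaccurateRounds, accurateRounds, and_assoc, not_exists, not_lt]
  set n := explCount S σ α a x (T + 1)
  set f := ((Finset.range (T + 1)).filter fun t =>
      K < t ∧ ¬ Exploits S σ α a x t ∧ Forced S σ α β a x t).card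
  set A := (inaccurateRounds S σ α β θ ε a x T).card
  set B := (accurateRounds S σ α β θ ε a x T).card
  have hhalf : ∀ m : ℕ, (β m : ℝ) ≤ m / 2 := fun m => by exact_mod_cast hβ_half m
  have hsub : ∀ m k : ℕ, (β ((m + k : ℕ) : ℝ≥0) : ℝ) ≤ β m + β k := fun m k => by
    push_cast
    exact_mod_cast hβ_sub m k
  have h2 : (f : ℝ) ≤ (n : ℝ) / 2 := h1.trans (hhalf n)
  have h3 : (n : ℝ) = f + (A + B) := by exact_mod_cast hsplit
  have h4 : n ≤ (A + B) + (A + B) := by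
    have : (n : ℝ) ≤ (A + B) + (A + B) := by linarith
    exact_mod_cast this
  have h5 : (β (n : ℝ≥0) : ℝ) ≤ β (((A + B) + (A + B) : ℕ) : ℝ≥0) := by
    exact_mod_cast hβ (by exact_mod_cast h4)
  linarith [hsub (A + B) (A + B), hsub A B, hhalf A]

theorem card_accurateRounds_le_sum {θ : Fin K → ℝ} {ε : ℝ} {T : ℕ} (hα : 0 < α)
    (h : FollowsAlgorithm S σ α β c a x)
    (huniq : ∀ t, K < t → t ≤ T → ∃ b, IsUniqueBest (empMean S a x t) b) :
    (((accurateRounds S σ α β θ ε a x T).card : ℕ) : ℝ≥0∞) ≤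
      ENNReal.ofReal (4 * α * Real.log T) * ∑ i, cSup c θ ε i + K := by
  classical
  rw [Finset.card_eq_sum_card_fiberwise (f := a) (t := Finset.univ) (fun t _ => by simp),
    Nat.cast_sum, Finset.mul_sum]
  refine (Finset.sum_le_sum fun i _ => card_accurateRounds_le hα h huniq i).trans_eq ?_
  rw [Finset.sum_add_distrib]
  simp

theorem sum_gap_accurateRounds_le {θ : Fin K → ℝ} {ε : ℝ} {T : ℕ} (hα : 0 < α)
    (h : FollowsAlgorithm S σ α β c a x)
    (huniq : ∀ t, K < t → t ≤ T → ∃ b, IsUniqueBest (empMean S a x t) b) :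
    ∑ t ∈ accurateRounds S σ α β θ ε a x T, ENNReal.ofReal (gap θ (a t)) ≤
      ENNReal.ofReal (4 * α * Real.log T) * ∑ i, cSup c θ ε i * ENNReal.ofReal (gap θ i) +
        K * ENNReal.ofReal (maxGap θ) := by
  classical
  calc ∑ t ∈ accurateRounds S σ α β θ ε a x T, ENNReal.ofReal (gap θ (a t))
      = ∑ i, ((((accurateRounds S σ α β θ ε a x T).filter fun t => a t = i).card : ℕ) : ℝ≥0∞) *
          ENNReal.ofReal (gap θ i) := by
        rw [← Finset.sum_fiberwise _ a]
        refine Finset.sum_congr rfl fun i _ => ?_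
        rw [Finset.sum_congr rfl fun t ht => by rw [(Finset.mem_filter.1 ht).2], Finset.sum_const,
          nsmul_eq_mul]
    _ ≤ ∑ i, (ENNReal.ofReal (4 * α * Real.log T) * (cSup c θ ε i * ENNReal.ofReal (gap θ i)) +
          ENNReal.ofReal (maxGap θ)) := by
        refine Finset.sum_le_sum fun i _ => ?_
        refine (mul_le_mul_left (card_accurateRounds_le hα h huniq i) _).trans ?_
        rw [add_mul, one_mul, mul_assoc]
        gcongr
        exact gap_le_maxGap θ i
    _ = _ := by
        rw [Finset.sum_add_distrib, Finset.mul_sum]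
        simp

theorem sum_union_le_ennreal {ι : Type*} [DecidableEq ι] (s t : Finset ι) (f : ι → ℝ≥0∞) :
    ∑ i ∈ s ∪ t, f i ≤ ∑ i ∈ s, f i + ∑ i ∈ t, f i := by
  rw [← Finset.sum_union_inter]
  exact le_self_add

open scoped Classical in
/-- The regret of a single run. Apart from the rounds in which the estimates are bad, the learner
pays for the initial rounds, for the forced exploration rounds, and for the exploration rounds
which the linear program asks for. -/
theorem sum_gap_le (hα : 0 < α) (hβ : Monotone β) (hβ_half : ∀ n : ℕ, β n ≤ n / 2)
    (hβ_sub : ∀ m n : ℕ, β (m + n) ≤ β m + β n) {θ : Fin K → ℝ} {ε : ℝ} {T : ℕ}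
    (h : FollowsAlgorithm S σ α β c a x)
    (huniq : ∀ t, K < t → t ≤ T → ∃ b, IsUniqueBest (empMean S a x t) b) :
    ∑ t ∈ Finset.Icc 1 T, ENNReal.ofReal (gap θ (a t)) ≤
      ENNReal.ofReal (maxGap θ) * (2 * K +
        (((Finset.range (T + 1)).filter fun t => K < t ∧ ConfFails S σ α θ a x t).card : ℕ) +
        2 * ((inaccurateRounds S σ α β θ ε a x T).card : ℕ)) +
      2 * ENNReal.ofReal (maxGap θ) *
        extend β (ENNReal.ofReal (4 * α * Real.log T) * ∑ i, cSup c θ ε i + K) +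
      ENNReal.ofReal (4 * α * Real.log T) * ∑ i, cSup c θ ε i * ENNReal.ofReal (gap θ i) := by
  have hK : 0 < K := Fin.pos (a 0)
  set d := ENNReal.ofReal (maxGap θ)
  set e := extend β (ENNReal.ofReal (4 * α * Real.log T) * ∑ i, cSup c θ ε i + K)
  set U := (Finset.range (T + 1)).filter fun t => K < t ∧ ConfFails S σ α θ a x t
  set G := (Finset.range (T + 1)).filter fun t =>
      K < t ∧ ¬ Exploits S σ α a x t ∧ Forced S σ α β a x t
  set A := inaccurateRounds S σ α β θ ε a x T
  set B := accurateRounds S σ α β θ ε a x T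
  have hGA : (G.card : ℝ≥0∞) ≤ A.card + 2 * e := by
    have h1 : (G.card : ℝ) ≤ A.card + 2 * β B.card :=
      card_forced_le_add hβ hβ_half hβ_sub h T
    have h2 : (G.card : ℝ≥0) ≤ A.card + 2 * β B.card := by exact_mod_cast h1
    have h3 : (G.card : ℝ≥0∞) ≤ A.card + 2 * (β B.card : ℝ≥0∞) := by exact_mod_cast h2
    refine h3.trans ?_
    gcongr
    refine le_iSup₂ (f := fun (y : ℝ≥0) (_ : (y : ℝ≥0∞) ≤ _) => (β y : ℝ≥0∞)) (B.card : ℝ≥0) ?_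
    exact_mod_cast card_accurateRounds_le_sum hα h huniq
  have hcard : ∀ s : Finset ℕ, ∑ t ∈ s, ENNReal.ofReal (gap θ (a t)) ≤ s.card * d := fun s => by
    rw [← nsmul_eq_mul]
    exact Finset.sum_le_card_nsmul _ _ _ fun t _ =>
      ENNReal.ofReal_le_ofReal (gap_le_maxGap θ (a t))
  calc ∑ t ∈ Finset.Icc 1 T, ENNReal.ofReal (gap θ (a t))
      ≤ ∑ t ∈ Finset.Icc 1 K ∪ (U ∪ (G ∪ (A ∪ B))), ENNReal.ofReal (gap θ (a t)) := by
        refine Finset.sum_le_sum_of_ne_zero fun t ht hne => ?_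
        rw [Finset.mem_Icc] at ht
        have htT : t ∈ Finset.range (T + 1) := Finset.mem_range.2 (by omega)
        simp only [Finset.mem_union]
        by_cases hKt : K < t
        swap
        · exact Or.inl (Finset.mem_Icc.2 ⟨ht.1, not_lt.1 hKt⟩)
        refine Or.inr ?_
        by_cases hex : Exploits S σ α a x t
        · refine Or.inl (Finset.mem_filter.2 ⟨htT, hKt, ?_⟩)
          by_contra hconf
          have hb := isBest_of_exploits hα (by omega) (h.numObs_pos hKt) hex hconf
            (h.exploit t hKt hex)
          exact hne (by rw [hb.gap_eq, sub_self, ENNReal.ofReal_zero])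
        refine Or.inr ?_
        by_cases hf : Forced S σ α β a x t
        · exact Or.inl (Finset.mem_filter.2 ⟨htT, hKt, hex, hf⟩)
        refine Or.inr ?_
        by_cases hacc : ∃ j, ε < |empMean S a x t j - θ j|
        · exact Or.inl (Finset.mem_filter.2 ⟨htT, hKt, hex, hf, hacc⟩)
        · exact Or.inr (Finset.mem_filter.2 ⟨htT, hKt, hex, hf, fun j =>
            not_lt.1 (not_exists.1 hacc j)⟩)
    _ ≤ (Finset.Icc 1 K).card * d + (U.card * d + (G.card * d + (A.card * d +
          (ENNReal.ofReal (4 * α * Real.log T) * ∑ i, cSup c θ ε i * ENNReal.ofReal (gap θ i) +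
            K * d)))) := by
        refine (sum_union_le_ennreal _ _ _).trans (add_le_add (hcard _) ?_)
        refine (sum_union_le_ennreal _ _ _).trans (add_le_add (hcard _) ?_)
        refine (sum_union_le_ennreal _ _ _).trans (add_le_add (hcard _) ?_)
        exact (sum_union_le_ennreal _ _ _).trans
          (add_le_add (hcard _) (sum_gap_accurateRounds_le hα h huniq))
    _ ≤ K * d + (U.card * d + ((A.card + 2 * e) * d + (A.card * d +
          (ENNReal.ofReal (4 * α * Real.log T) * ∑ i, cSup c θ ε i * ENNReal.ofReal (gap θ i) +
            K * d)))) := by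
        rw [Nat.card_Icc, Nat.add_sub_cancel]
        gcongr
    _ = _ := by ring

/-! ### The exponential martingale of the observations of an action -/

/-- The factor contributed by an observation `y` of an action with mean `m` to the exponential
martingale with parameter `l`. -/
noncomputable def expFactor (σ : ℝ≥0) (l m y : ℝ) : ℝ≥0∞ :=
  ENNReal.ofReal (Real.exp (l * (y - m) - l ^ 2 * (σ : ℝ) ^ 2 / 2))

theorem measurable_expFactor (σ : ℝ≥0) (l m : ℝ) : Measurable (expFactor σ l m) := by
  unfold expFactor
  fun_prop

/-- The exponential martingale of the observations of `j` up to round `t`. -/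
noncomputable def expMartingale {Ω : Type*} (S : Fin K → Finset (Fin K)) (σ : ℝ≥0) (θ : Fin K → ℝ)
    (X : ℕ → Fin K → Fin K → Ω → ℝ) (I : ℕ → Ω → Fin K) (j : Fin K) (l : ℝ) (t : ℕ) (ω : Ω) :
    ℝ≥0∞ :=
  ∏ s ∈ Finset.Ico 1 (t + 1),
    if j ∈ S (I s ω) then expFactor σ l (θ j) (X s (I s ω) j ω) else 1

theorem expMartingale_eq {Ω : Type*} (S : Fin K → Finset (Fin K)) (σ : ℝ≥0) (θ : Fin K → ℝ)
    (X : ℕ → Fin K → Fin K → Ω → ℝ) (I : ℕ → Ω → Fin K) (j : Fin K) (l : ℝ) (t : ℕ) (ω : Ω) :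
    expMartingale S σ θ X I j l t ω = ENNReal.ofReal (Real.exp
      (numObs S (fun r => I r ω) j (t + 1) *
        (l * (empMean S (fun r => I r ω) (fun r j => X r (I r ω) j ω) (t + 1) j - θ j) -
          l ^ 2 * (σ : ℝ) ^ 2 / 2))) := by
  have h1 : (numObs S (fun r => I r ω) j (t + 1) : ℝ) * (l ^ 2 * (σ : ℝ) ^ 2 / 2) =
      ∑ s ∈ Finset.Ico 1 (t + 1), if j ∈ S (I s ω) then l ^ 2 * (σ : ℝ) ^ 2 / 2 else 0 := by
    rw [← Finset.sum_filter, Finset.sum_const, nsmul_eq_mul, numObs]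
  rw [mul_sub, mul_left_comm, numObs_mul_empMean_sub, h1, Finset.mul_sum,
    ← Finset.sum_sub_distrib, Real.exp_sum, ENNReal.ofReal_prod_of_nonneg fun _ _ =>
      (Real.exp_pos _).le, expMartingale]
  refine Finset.prod_congr rfl fun s _ => ?_
  split_ifs <;> simp [expFactor]

/-! ### The history is adapted to the filtration -/

variable {Ω : Type*} [mΩ : MeasurableSpace Ω] {P : Measure Ω}
  {S : Fin K → Finset (Fin K)} {σ : ℝ≥0} {θ : Fin K → ℝ} {F : Filtration ℕ mΩ}
  {X : ℕ → Fin K → Fin K → Ω → ℝ} {Y : ℕ → Fin K → Ω → ℝ} {I : ℕ → Ω → Fin K}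

theorem measurableSet_feasible (S : Fin K → Finset (Fin K)) (σ : ℝ≥0) :
    MeasurableSet {p : (Fin K → ℝ) × (Fin K → ℝ) | p.1 ∈ feasible S σ p.2} := by
  have hgap : ∀ j, Measurable fun p : (Fin K → ℝ) × (Fin K → ℝ) => gap p.2 j := fun j => by
    unfold gap
    exact (Measurable.iSup fun i => by fun_prop).sub (by fun_prop)
  have hsecond : ∀ b, Measurable fun p : (Fin K → ℝ) × (Fin K → ℝ) => secondGap p.2 b :=
    fun b => by
      unfold secondGap
      exact Measurable.iInf fun j => hgap j
  have huniq : ∀ b, MeasurableSet {p : (Fin K → ℝ) × (Fin K → ℝ) | IsUniqueBest p.2 b} :=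
    fun b => by
      simp only [IsUniqueBest, Set.ofPred_forall]
      exact .iInter fun j => .iInter fun _ =>
        measurableSet_lt (by fun_prop) (by fun_prop)
  have hfst : ∀ j, Measurable fun p : (Fin K → ℝ) × (Fin K → ℝ) => ∑ i with j ∈ S i, p.1 i :=
    fun j => by fun_prop
  change MeasurableSet {p : (Fin K → ℝ) × (Fin K → ℝ) | (∀ i, 0 ≤ p.1 i) ∧
    ∃ b, IsUniqueBest p.2 b ∧
      (∀ j, j ≠ b → 2 * (σ : ℝ) ^ 2 / gap p.2 j ^ 2 ≤ ∑ i with j ∈ S i, p.1 i) ∧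
      2 * (σ : ℝ) ^ 2 / secondGap p.2 b ^ 2 ≤ ∑ i with b ∈ S i, p.1 i}
  simp only [Set.ofPred_and, Set.ofPred_forall, Set.ofPred_exists]
  refine .inter (.iInter fun i => measurableSet_le measurable_const (by fun_prop))
    (.iUnion fun b => (huniq b).inter (.inter (.iInter fun j => .iInter fun _ => ?_) ?_))
  · exact measurableSet_le (((hgap j).pow_const 2).const_div _) (hfst j)
  · exact measurableSet_le (((hsecond b).pow_const 2).const_div _) (hfst b)

namespace IsInteraction

theorem measurable_action (hI : IsInteraction P S σ θ F X Y I) {s t : ℕ} (hs : 1 ≤ s)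
    (hst : s ≤ t + 1) : Measurable[F t] (I s) := by
  obtain ⟨s, rfl⟩ := Nat.exists_eq_add_of_le' hs
  exact (hI.action_meas s).mono (F.mono (by omega)) le_rfl

theorem measurable_obs (hI : IsInteraction P S σ θ F X Y I) {s t : ℕ} (hs : 1 ≤ s)
    (hst : s ≤ t) (j : Fin K) : Measurable[F t] fun ω => X s (I s ω) j ω := by
  have hX : ∀ k, Measurable[F t] (X s k j) := fun k => by
    obtain ⟨s, rfl⟩ := Nat.exists_eq_add_of_le' hs
    exact (hI.obs_meas s k j).mono (F.mono hst) le_rfl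
  have h : (fun ω => X s (I s ω) j ω) = fun ω => ∑ k, if I s ω = k then X s k j ω else 0 := by
    ext ω
    simp
  rw [h]
  refine Finset.measurable_fun_sum _ fun k _ => ?_
  exact Measurable.ite (hI.measurable_action hs (by omega) (measurableSet_singleton k)) (hX k)
    measurable_const

/-- A real function of the actions of past rounds is known. -/
theorem measurable_sum_action (hI : IsInteraction P S σ θ F X Y I) {s t : ℕ} (hst : s ≤ t + 2)
    (f : Fin K → ℝ) : Measurable[F t] fun ω => ∑ r ∈ Finset.Ico 1 s, f (I r ω) := by
  refine Finset.measurable_fun_sum _ fun r hr => ?_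
  rw [Finset.mem_Ico] at hr
  exact (measurable_of_finite f).comp (hI.measurable_action hr.1 (by omega))

theorem measurable_numObs (hI : IsInteraction P S σ θ F X Y I) {s t : ℕ} (hst : s ≤ t + 2)
    (j : Fin K) : Measurable[F t] fun ω => (numObs S (fun r => I r ω) j s : ℝ) := by
  simpa [numObs, Finset.sum_boole] using
    hI.measurable_sum_action hst fun k => if j ∈ S k then 1 else 0

theorem measurable_numPlays (hI : IsInteraction P S σ θ F X Y I) {s t : ℕ} (hst : s ≤ t + 2)
    (i : Fin K) : Measurable[F t] fun ω => (numPlays (fun r => I r ω) i s : ℝ) := by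
  simpa [numPlays, Finset.sum_boole] using
    hI.measurable_sum_action hst fun k => if k = i then 1 else 0

theorem measurable_sumObs (hI : IsInteraction P S σ θ F X Y I) {s t : ℕ} (hst : s ≤ t + 1)
    (j : Fin K) : Measurable[F t] fun ω =>
      ∑ r ∈ (Finset.Ico 1 s).filter (fun r => j ∈ S (I r ω)), X r (I r ω) j ω := by
  simp only [Finset.sum_filter]
  refine Finset.measurable_fun_sum _ fun r hr => ?_
  rw [Finset.mem_Ico] at hr
  exact Measurable.ite
    (hI.measurable_action hr.1 (by omega) (Set.toFinite {k | j ∈ S k}).measurableSet)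
    (hI.measurable_obs hr.1 (by omega) j) measurable_const

theorem measurable_empMean (hI : IsInteraction P S σ θ F X Y I) {s t : ℕ} (hst : s ≤ t + 1)
    (j : Fin K) : Measurable[F t] fun ω =>
      empMean S (fun r => I r ω) (fun r j => X r (I r ω) j ω) s j :=
  (hI.measurable_sumObs hst j).div (hI.measurable_numObs (by omega) j)

theorem measurableSet_exploits (hI : IsInteraction P S σ θ F X Y I) (α : ℝ) {s t : ℕ}
    (hst : s ≤ t + 1) : MeasurableSet[F t]
      {ω | Exploits S σ α (fun r => I r ω) (fun r j => X r (I r ω) j ω) s} := by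
  have h : Measurable[F t] fun ω =>
      ((fun i => (numPlays (fun r => I r ω) i s : ℝ) / (4 * α * Real.log s),
        empMean S (fun r => I r ω) (fun r j => X r (I r ω) j ω) s) :
          (Fin K → ℝ) × (Fin K → ℝ)) := by
    refine Measurable.prodMk ?_ ?_
    · exact @measurable_pi_lambda _ _ _ (F t) _ _ fun i =>
        (hI.measurable_numPlays (by omega) i).div_const _
    · exact @measurable_pi_lambda _ _ _ (F t) _ _ fun i => hI.measurable_empMean hst i
  exact h (measurableSet_feasible S σ)

theorem measurable_explCount (hI : IsInteraction P S σ θ F X Y I) (α : ℝ) {s t : ℕ}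
    (hst : s ≤ t + 1) : Measurable[F t] fun ω =>
      explCount S σ α (fun r => I r ω) (fun r j => X r (I r ω) j ω) s := by
  classical
  induction s with
  | zero => exact measurable_const
  | succ s ih =>
    have ih' := ih (by omega)
    have hset : MeasurableSet[F t] {ω | K < s ∧
        ¬ Exploits S σ α (fun r => I r ω) (fun r j => X r (I r ω) j ω) s} :=
      MeasurableSet.inter (.const _) (hI.measurableSet_exploits α (by omega)).compl
    simp only [explCount]
    convert Measurable.ite hset (ih'.add_const 1) ih' using 2

theorem measurableSet_confFails (hI : IsInteraction P S σ θ F X Y I) (α : ℝ) {s t : ℕ}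
    (hst : s ≤ t + 1) : MeasurableSet[F t]
      {ω | ConfFails S σ α θ (fun r => I r ω) (fun r j => X r (I r ω) j ω) s} := by
  simp only [ConfFails, Set.ofPred_exists, Set.ofPred_and]
  refine .iUnion fun j => .inter ?_ ?_
  · have := measurableSet_lt (measurable_const (a := (0 : ℝ)))
      (hI.measurable_numObs (s := s) (t := t) (by omega) j)
    simpa using this
  · exact measurableSet_lt
      (Real.continuous_sqrt.measurable.comp ((hI.measurable_numObs (by omega) j).const_div _))
      (continuous_abs.measurable.comp ((hI.measurable_empMean hst j).sub_const _))

/-! ### Deviations of the estimates -/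

/-- A function of the observations and payoffs of a round is independent of the past. -/
theorem indep_comap (hI : IsInteraction P S σ θ F X Y I) (t : ℕ) {E : Type*} [MeasurableSpace E]
    {g : (Fin K → Fin K → ℝ) × (Fin K → ℝ) → E} (hg : Measurable g) :
    Indep (F t) (MeasurableSpace.comap (fun ω =>
      g (fun i j => X (t + 1) i j ω, fun i => Y (t + 1) i ω)) inferInstance) P := by
  refine indep_of_indep_of_le_right (hI.indep_past t) ?_
  rw [← Function.comp_def g, ← MeasurableSpace.comap_comp]
  exact MeasurableSpace.comap_mono hg.comap_le

theorem measurable_obs_top (hI : IsInteraction P S σ θ F X Y I) (t : ℕ) (i j : Fin K) :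
    Measurable (X (t + 1) i j) := (hI.obs_meas t i j).mono (F.le _) le_rfl

theorem lintegral_expFactor {Z : Ω → ℝ} (hZ : Measurable Z) {m : ℝ}
    (hlaw : P.map Z = gaussianReal m (σ ^ 2)) (l : ℝ) :
    ∫⁻ ω, expFactor σ l m (Z ω) ∂P = 1 := by
  rw [← lintegral_map (measurable_expFactor σ l m) hZ, hlaw]
  unfold expFactor
  have h : ∀ y : ℝ, Real.exp (l * (y - m) - l ^ 2 * (σ : ℝ) ^ 2 / 2) =
      Real.exp (-(m * l + (σ : ℝ) ^ 2 * l ^ 2 / 2)) * Real.exp (l * y) := fun y => by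
    rw [← Real.exp_add]
    ring_nf
  rw [← ofReal_integral_eq_lintegral_ofReal]
  · simp_rw [h]
    rw [integral_const_mul]
    have := congrFun (mgf_fun_id_gaussianReal (μ := m) (v := σ ^ 2)) l
    rw [mgf] at this
    rw [this, ← Real.exp_add]
    simp
  · simp_rw [h]
    exact (integrable_exp_mul_gaussianReal l).const_mul _
  · exact ae_of_all _ fun y => (Real.exp_pos _).le

theorem measurable_expMartingale (hI : IsInteraction P S σ θ F X Y I) (j : Fin K) (l : ℝ)
    (t : ℕ) : Measurable[F t] (expMartingale S σ θ X I j l t) := by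
  unfold expMartingale
  refine Finset.measurable_fun_prod _ fun s hs => ?_
  rw [Finset.mem_Ico] at hs
  exact Measurable.ite
    (hI.measurable_action hs.1 (by omega) (Set.toFinite {k | j ∈ S k}).measurableSet)
    ((measurable_expFactor σ l (θ j)).comp (hI.measurable_obs hs.1 (by omega) j)) measurable_const

theorem setLIntegral_expMartingale_succ [IsProbabilityMeasure P]
    (hI : IsInteraction P S σ θ F X Y I) (j : Fin K)
    (l : ℝ) (t : ℕ) {A : Set Ω} (hA : MeasurableSet[F t] A) :
    ∫⁻ ω in A, expMartingale S σ θ X I j l (t + 1) ω ∂P =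
      ∫⁻ ω in A, expMartingale S σ θ X I j l t ω ∂P := by
  classical
  set M := expMartingale S σ θ X I j l t
  have hM : Measurable[F t] M := hI.measurable_expMartingale j l t
  let g : Fin K → Ω → ℝ≥0∞ := fun k ω =>
    if j ∈ S k then expFactor σ l (θ j) (X (t + 1) k j ω) else 1
  have hAk : ∀ k, MeasurableSet[F t] (A ∩ I (t + 1) ⁻¹' {k}) := fun k =>
    MeasurableSet.inter hA (hI.action_meas t (measurableSet_singleton k))
  have hMk : ∀ k, Measurable[F t] ((A ∩ I (t + 1) ⁻¹' {k}).indicator M) := fun k =>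
    hM.indicator (hAk k)
  have hgm : ∀ k, Measurable (g k) := fun k => by
    by_cases hk : j ∈ S k
    · simp only [g, hk, if_true]
      exact (measurable_expFactor σ l (θ j)).comp (hI.measurable_obs_top t k j)
    · simp only [g, hk, if_false]
      exact measurable_const
  have hg : ∀ k, ∫⁻ ω, g k ω ∂P = 1 := fun k => by
    by_cases hk : j ∈ S k
    · simpa only [g, hk, if_true] using
        lintegral_expFactor (hI.measurable_obs_top t k j) (hI.obs_law t k j hk) l
    · simp [g, hk]
  have hprod : ∀ k, ∫⁻ ω, (A ∩ I (t + 1) ⁻¹' {k}).indicator M ω * g k ω ∂P =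
      ∫⁻ ω, (A ∩ I (t + 1) ⁻¹' {k}).indicator M ω ∂P := fun k => by
    have hmeas : Measurable fun p : (Fin K → Fin K → ℝ) × (Fin K → ℝ) =>
        if j ∈ S k then expFactor σ l (θ j) (p.1 k j) else 1 := by
      by_cases hk : j ∈ S k
      · simp only [hk, if_true]
        exact (measurable_expFactor σ l (θ j)).comp (by fun_prop)
      · simp only [hk, if_false]
        exact measurable_const
    rw [lintegral_mul_eq_lintegral_mul_lintegral_of_independent_measurableSpace (F.le t)
      (hgm k).comap_le (hI.indep_comap t hmeas) (hMk k) (comap_measurable _), hg, mul_one]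
  have hsum : ∀ f : Fin K → Ω → ℝ≥0∞, ∀ ω, A.indicator (fun ω => M ω * f (I (t + 1) ω) ω) ω =
      ∑ k, (A ∩ I (t + 1) ⁻¹' {k}).indicator M ω * f k ω := fun f ω => by
    rw [Finset.sum_eq_single (I (t + 1) ω)]
    · by_cases hω : ω ∈ A <;> simp [hω]
    · intro k _ hk
      simp [hk.symm]
    · simp
  have hsucc : expMartingale S σ θ X I j l (t + 1) = fun ω => M ω * g (I (t + 1) ω) ω := by
    ext ω
    rw [expMartingale, Finset.prod_Ico_succ_top (by omega)]
    rfl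
  have hA' := F.le t _ hA
  rw [← lintegral_indicator hA', ← lintegral_indicator hA']
  rw [hsucc]
  have h1 : ∀ ω, A.indicator M ω = ∑ k, (A ∩ I (t + 1) ⁻¹' {k}).indicator M ω := fun ω => by
    simpa using hsum (fun _ _ => 1) ω
  simp_rw [hsum g, h1]
  have hmeas : ∀ k, Measurable fun ω => (A ∩ I (t + 1) ⁻¹' {k}).indicator M ω * g k ω := fun k =>
    ((hMk k).mono (F.le t) le_rfl).mul (hgm k)
  rw [lintegral_finsetSum _ fun k _ => hmeas k,
    lintegral_finsetSum _ fun k _ => (hMk k).mono (F.le t) le_rfl]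
  exact Finset.sum_congr rfl fun k _ => hprod k

theorem setLIntegral_expMartingale_of_le [IsProbabilityMeasure P]
    (hI : IsInteraction P S σ θ F X Y I) (j : Fin K)
    (l : ℝ) {t u : ℕ} (htu : t ≤ u) {A : Set Ω} (hA : MeasurableSet[F t] A) :
    ∫⁻ ω in A, expMartingale S σ θ X I j l u ω ∂P =
      ∫⁻ ω in A, expMartingale S σ θ X I j l t ω ∂P := by
  induction u, htu using Nat.le_induction with
  | base => rfl
  | succ u htu ih => rw [hI.setLIntegral_expMartingale_succ j l u (F.mono htu _ hA), ih]

theorem lintegral_expMartingale [IsProbabilityMeasure P]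
    (hI : IsInteraction P S σ θ F X Y I) (j : Fin K)
    (l : ℝ) (t : ℕ) : ∫⁻ ω, expMartingale S σ θ X I j l t ω ∂P = 1 := by
  have := hI.setLIntegral_expMartingale_of_le j l (Nat.zero_le t) (A := Set.univ) .univ
  simpa [expMartingale] using this

/-- Chernoff's bound at a stopping time. The disjoint events `A t` are known after round `t`, so
they describe a stopping rule; on them `j` has been observed at least `m` times, and its estimate
deviates by at least `r` in the direction `ρ = ±1`. -/
theorem sum_measure_deviation_le [IsProbabilityMeasure P]
    (hI : IsInteraction P S σ θ F X Y I) (hσ : 0 < σ) (j : Fin K)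
    {ρ m r : ℝ} (hρ : ρ ^ 2 = 1) (hr : 0 ≤ r) (s : Finset ℕ) (A : ℕ → Set Ω)
    (hA : ∀ t ∈ s, MeasurableSet[F t] (A t)) (hdisj : (s : Set ℕ).PairwiseDisjoint A)
    (hm : ∀ t ∈ s, ∀ ω ∈ A t, m ≤ (numObs S (fun r => I r ω) j (t + 1) : ℝ))
    (hdev : ∀ t ∈ s, ∀ ω ∈ A t, r ≤
      ρ * (empMean S (fun r => I r ω) (fun r j => X r (I r ω) j ω) (t + 1) j - θ j)) :
    ∑ t ∈ s, P (A t) ≤ ENNReal.ofReal (Real.exp (-(m * r ^ 2 / (2 * (σ : ℝ) ^ 2)))) := by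
  -- The parameter for which the bound on the martingale from below is largest.
  set l : ℝ := ρ * r / (σ : ℝ) ^ 2
  set v := ENNReal.ofReal (Real.exp (m * r ^ 2 / (2 * (σ : ℝ) ^ 2)))
  have hσ' : (0 : ℝ) < σ := hσ
  obtain ⟨u, hu⟩ := s.exists_nat_subset_range
  have hle : ∀ t ∈ s, v * P (A t) ≤ ∫⁻ ω in A t, expMartingale S σ θ X I j l u ω ∂P := by
    intro t ht
    rw [hI.setLIntegral_expMartingale_of_le j l (Finset.mem_range.1 (hu ht)).le (hA t ht),
      ← setLIntegral_const]
    refine setLIntegral_mono' (F.le t _ (hA t ht)) fun ω hω => ?_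
    rw [expMartingale_eq]
    refine ENNReal.ofReal_le_ofReal (Real.exp_le_exp.2 ?_)
    have h1 := hm t ht ω hω
    have h2 := hdev t ht ω hω
    set n : ℝ := (numObs S (fun r => I r ω) j (t + 1) : ℝ)
    set e := empMean S (fun r => I r ω) (fun r j => X r (I r ω) j ω) (t + 1) j - θ j
    have h3 : l * e - l ^ 2 * (σ : ℝ) ^ 2 / 2 = (2 * r * (ρ * e) - r ^ 2) / (2 * (σ : ℝ) ^ 2) := by
      simp only [l, div_pow, mul_pow, hρ]
      field_simp
    have hn : 0 ≤ n := Nat.cast_nonneg _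
    rw [h3, ← mul_div_assoc]
    refine div_le_div_of_nonneg_right ?_ (by positivity)
    calc m * r ^ 2 ≤ n * r ^ 2 := by gcongr
      _ ≤ n * (2 * r * (ρ * e) - r ^ 2) := by
        refine mul_le_mul_of_nonneg_left ?_ hn
        nlinarith
  have htotal : v * ∑ t ∈ s, P (A t) ≤ 1 := by
    rw [Finset.mul_sum]
    refine (Finset.sum_le_sum hle).trans ?_
    rw [← lintegral_biUnion_finset hdisj fun t ht => F.le t _ (hA t ht)]
    exact (setLIntegral_le_lintegral _ _).trans_eq (hI.lintegral_expMartingale j l u)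
  rw [Real.exp_neg, ENNReal.ofReal_inv_of_pos (Real.exp_pos _), ← one_div]
  rw [ENNReal.le_div_iff_mul_le (Or.inl (by simp [Real.exp_pos])) (Or.inl (by simp)), mul_comm]
  exact htotal

end IsInteraction

/-! ### The estimates are almost surely distinct -/

/-- A random variable without atoms almost surely differs from any independent one. -/
theorem ae_ne_of_indep {Ω : Type*} {m mΩ : MeasurableSpace Ω} {P : Measure Ω}
    [IsProbabilityMeasure P] (hm : m ≤ mΩ)
    {V Z : Ω → ℝ} (hV : Measurable V) (hZ : Measurable[m] Z)
    (hind : Indep m (MeasurableSpace.comap V inferInstance) P) (hatom : ∀ v, ∀ᵐ ω ∂P, V ω ≠ v) :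
    ∀ᵐ ω ∂P, V ω ≠ Z ω := by
  have hZ' : Measurable Z := hZ.mono hm le_rfl
  have hZV : Z ⟂ᵢ[P] V := indep_of_indep_of_le_left hind hZ.comap_le
  have hD : MeasurableSet {p : ℝ × ℝ | p.2 = p.1} :=
    measurableSet_eq_fun measurable_snd measurable_fst
  have hmap := hZV.map_prod_eq_prod_map_map hZ'.aemeasurable hV.aemeasurable
  have h0 : P.map (fun ω => (Z ω, V ω)) {p : ℝ × ℝ | p.2 = p.1} = 0 := by
    rw [hmap, Measure.prod_apply hD]
    refine (lintegral_congr fun z => ?_).trans lintegral_zero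
    have hz : Prod.mk z ⁻¹' {p : ℝ × ℝ | p.2 = p.1} = {z} := by
      ext y
      simp
    rw [hz, Measure.map_apply hV (measurableSet_singleton z)]
    simpa [ae_iff, Set.preimage] using hatom z
  rw [Measure.map_apply (hZ'.prodMk hV) hD] at h0
  simpa [ae_iff] using h0

namespace IsInteraction

theorem ae_obs_ne [IsProbabilityMeasure P] (hI : IsInteraction P S σ θ F X Y I) (hσ : 0 < σ)
    (t : ℕ) {k j : Fin K} (hj : j ∈ S k) (v : ℝ) : ∀ᵐ ω ∂P, X (t + 1) k j ω ≠ v := by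
  have hnull := nullSingletonClass_gaussianReal (μ := θ j) (pow_pos hσ 2).ne'
  have h : P.map (X (t + 1) k j) {v} = 0 := by
    rw [hI.obs_law t k j hj]
    exact measure_singleton v
  rw [Measure.map_apply (hI.measurable_obs_top t k j) (measurableSet_singleton v)] at h
  simpa [ae_iff, Set.preimage] using h

/-- A nontrivial linear combination of the observations of two actions in one round has no
atoms. -/
theorem ae_obs_comb_ne [IsProbabilityMeasure P] (hI : IsInteraction P S σ θ F X Y I)
    (hσ : 0 < σ) (t : ℕ) {k i j : Fin K} (hij : i ≠ j) (hk : i ∈ S k ∨ j ∈ S k) {p q : ℝ}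
    (hp : p ≠ 0) (hq : q ≠ 0) (v : ℝ) :
    ∀ᵐ ω ∂P, (if i ∈ S k then X (t + 1) k i ω else 0) * q -
      (if j ∈ S k then X (t + 1) k j ω else 0) * p ≠ v := by
  by_cases hi : i ∈ S k <;> by_cases hj : j ∈ S k
  · have hX : X (t + 1) k j ⟂ᵢ[P] X (t + 1) k i :=
      (hI.obs_indep t k).indepFun (i := ⟨j, hj⟩) (j := ⟨i, hi⟩) (by simpa using hij.symm)
    have hZ : Measurable[MeasurableSpace.comap (X (t + 1) k j) inferInstance]
        fun ω => (v + X (t + 1) k j ω * p) / q :=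
      (((comap_measurable _).mul_const p).const_add v).div_const q
    filter_upwards [ae_ne_of_indep (hI.measurable_obs_top t k j).comap_le
      (hI.measurable_obs_top t k i) hZ hX (hI.ae_obs_ne hσ t hi)] with ω hω heq
    rw [if_pos hi, if_pos hj] at heq
    exact hω (by rw [eq_div_iff hq]; linarith)
  · filter_upwards [hI.ae_obs_ne hσ t hi (v / q)] with ω hω heq
    rw [if_pos hi, if_neg hj] at heq
    exact hω (by rw [eq_div_iff hq]; linarith)
  · filter_upwards [hI.ae_obs_ne hσ t hj (-v / p)] with ω hω heq
    rw [if_neg hi, if_pos hj] at heq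
    exact hω (by rw [eq_div_iff hp]; linarith)
  · exact absurd hk (by simp [hi, hj])

/-- The estimates of two actions, compared after clearing denominators, differ almost surely: the
last observation of one of them is independent of the past and, if both are observed in that round,
of the other observation. -/
theorem ae_sumObs_mul_ne [IsProbabilityMeasure P] (hI : IsInteraction P S σ θ F X Y I)
    (hσ : 0 < σ) {i j : Fin K} (hij : i ≠ j) (t : ℕ) :
    ∀ᵐ ω ∂P, 0 < numObs S (fun r => I r ω) i (t + 1) → 0 < numObs S (fun r => I r ω) j (t + 1) →
      (∑ r ∈ (Finset.Ico 1 (t + 1)).filter (fun r => i ∈ S (I r ω)), X r (I r ω) i ω) *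
          numObs S (fun r => I r ω) j (t + 1) ≠
        (∑ r ∈ (Finset.Ico 1 (t + 1)).filter (fun r => j ∈ S (I r ω)), X r (I r ω) j ω) *
          numObs S (fun r => I r ω) i (t + 1) := by
  induction t with
  | zero => exact ae_of_all _ fun ω h => by simp [numObs] at h
  | succ t ih =>
    let A : Fin K → Ω → ℝ := fun i ω =>
      ∑ r ∈ (Finset.Ico 1 (t + 1)).filter (fun r => i ∈ S (I r ω)), X r (I r ω) i ω
    have hA : ∀ i, Measurable[F t] (A i) := fun i => hI.measurable_sumObs le_rfl i
    -- The counts `p` and `q` are random, but take countably many values.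
    have key : ∀ (k : Fin K) (p q : ℕ), ∀ᵐ ω ∂P, (i ∈ S k ∨ j ∈ S k) → 0 < p → 0 < q →
        (if i ∈ S k then X (t + 1) k i ω else 0) * (q : ℝ) -
          (if j ∈ S k then X (t + 1) k j ω else 0) * (p : ℝ) ≠ A j ω * p - A i ω * q := by
      intro k p q
      by_cases hk : (i ∈ S k ∨ j ∈ S k) ∧ 0 < p ∧ 0 < q
      swap
      · exact ae_of_all _ fun ω h1 h2 h3 => absurd ⟨h1, h2, h3⟩ hk
      have hg : Measurable fun z : (Fin K → Fin K → ℝ) × (Fin K → ℝ) =>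
          (if i ∈ S k then z.1 k i else 0) * (q : ℝ) -
            (if j ∈ S k then z.1 k j else 0) * (p : ℝ) := by
        refine Measurable.sub (Measurable.mul_const ?_ _) (Measurable.mul_const ?_ _)
        · split_ifs <;> fun_prop
        · split_ifs <;> fun_prop
      have hmeas : Measurable fun ω =>
          ((fun i j => X (t + 1) i j ω, fun i => Y (t + 1) i ω) :
            (Fin K → Fin K → ℝ) × (Fin K → ℝ)) := by
        refine Measurable.prodMk ?_ ?_
        · exact measurable_pi_lambda _ fun i => measurable_pi_lambda _ fun j =>
            hI.measurable_obs_top t i j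
        · exact measurable_pi_lambda _ fun i => (hI.payoff_meas t i).mono (F.le _) le_rfl
      have hp : (p : ℝ) ≠ 0 := by exact_mod_cast hk.2.1.ne'
      have hq : (q : ℝ) ≠ 0 := by exact_mod_cast hk.2.2.ne'
      filter_upwards [ae_ne_of_indep (F.le t) (hg.comp hmeas)
        (((hA j).mul_const (p : ℝ)).sub ((hA i).mul_const (q : ℝ))) (hI.indep_comap t hg)
        (hI.ae_obs_comb_ne hσ t hij hk.1 hp hq)] with ω hω _ _ _
      exact hω
    filter_upwards [ih, ae_all_iff.2 fun k => ae_all_iff.2 fun p => ae_all_iff.2 fun q => key k p q]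
      with ω hω hkey hi hj heq
    have hsum : ∀ i, (∑ r ∈ (Finset.Ico 1 (t + 1 + 1)).filter (fun r => i ∈ S (I r ω)),
        X r (I r ω) i ω) = A i ω + if i ∈ S (I (t + 1) ω) then X (t + 1) (I (t + 1) ω) i ω else 0 :=
      fun i => by
        simp only [A]
        rw [Finset.sum_filter, Finset.sum_filter, Finset.sum_Ico_succ_top (by omega)]
    have hnum : ∀ i, i ∉ S (I (t + 1) ω) → numObs S (fun r => I r ω) i (t + 1 + 1) =
        numObs S (fun r => I r ω) i (t + 1) := fun i hi => by
      simp only [numObs, Finset.card_filter]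
      rw [Finset.sum_Ico_succ_top (by omega), if_neg hi, add_zero]
    rw [hsum, hsum] at heq
    by_cases hk : i ∈ S (I (t + 1) ω) ∨ j ∈ S (I (t + 1) ω)
    · exact hkey _ _ _ hk hi hj (by linarith)
    · rw [not_or] at hk
      rw [hnum i hk.1] at hi heq
      rw [hnum j hk.2] at hj heq
      rw [if_neg hk.1, if_neg hk.2, add_zero, add_zero] at heq
      exact hω hi hj heq

theorem ae_exists_isUniqueBest [IsProbabilityMeasure P] (hI : IsInteraction P S σ θ F X Y I)
    (hσ : 0 < σ) : ∀ᵐ ω ∂P, ∀ t, (∀ j, 0 < numObs S (fun r => I r ω) j t) →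
      ∃ b, IsUniqueBest (empMean S (fun r => I r ω) (fun r j => X r (I r ω) j ω) t) b := by
  have h : ∀ t i j, ∀ᵐ ω ∂P, i ≠ j → 0 < numObs S (fun r => I r ω) i (t + 1) →
      0 < numObs S (fun r => I r ω) j (t + 1) →
      (∑ r ∈ (Finset.Ico 1 (t + 1)).filter (fun r => i ∈ S (I r ω)), X r (I r ω) i ω) *
          numObs S (fun r => I r ω) j (t + 1) ≠
        (∑ r ∈ (Finset.Ico 1 (t + 1)).filter (fun r => j ∈ S (I r ω)), X r (I r ω) j ω) *
          numObs S (fun r => I r ω) i (t + 1) := fun t i j => by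
    by_cases hij : i = j
    · exact ae_of_all _ fun ω h => absurd hij h
    · filter_upwards [hI.ae_sumObs_mul_ne hσ hij t] with ω hω _
      exact hω
  filter_upwards [ae_all_iff.2 fun t => ae_all_iff.2 fun i => ae_all_iff.2 fun j => h t i j]
    with ω hω t hn
  have : Nonempty (Fin K) := ⟨I 0 ω⟩
  refine exists_isUniqueBest fun i j hij => ?_
  by_contra hne
  rcases t with _ | t
  · have := hn i
    simp [numObs] at this
  refine hω t i j hne (hn i) (hn j) ?_
  have hi : (numObs S (fun r => I r ω) i (t + 1) : ℝ) ≠ 0 := by exact_mod_cast (hn i).ne'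
  have hj : (numObs S (fun r => I r ω) j (t + 1) : ℝ) ≠ 0 := by exact_mod_cast (hn j).ne'
  exact (div_eq_div_iff hi hj).1 hij

/-! ### Regret and gaps -/

theorem integral_payoff [IsProbabilityMeasure P] (hI : IsInteraction P S σ θ F X Y I) (t : ℕ) :
    ∫ ω, Y (t + 1) (I (t + 1) ω) ω ∂P = ∫ ω, θ (I (t + 1) ω) ∂P := by
  have hset : ∀ k, MeasurableSet[F t] (I (t + 1) ⁻¹' {k}) := fun k =>
    hI.action_meas t (measurableSet_singleton k)
  have hset' : ∀ k, MeasurableSet (I (t + 1) ⁻¹' {k}) := fun k => F.le t _ (hset k)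
  have hsum : ∀ (f : Fin K → Ω → ℝ) (ω : Ω), f (I (t + 1) ω) ω =
      ∑ k, (I (t + 1) ⁻¹' {k}).indicator (f k) ω := fun f ω => by
    rw [Finset.sum_eq_single (I (t + 1) ω)]
    · simp
    · intro k _ hk
      simp [hk.symm]
    · simp
  have hterm : ∀ k, ∫ ω, (I (t + 1) ⁻¹' {k}).indicator (Y (t + 1) k) ω ∂P =
      ∫ ω, (I (t + 1) ⁻¹' {k}).indicator (fun _ => θ k) ω ∂P := fun k => by
    have hmeas : Measurable[F t] ((I (t + 1) ⁻¹' {k}).indicator fun _ => (1 : ℝ)) :=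
      measurable_const.indicator (hset k)
    have hind : (I (t + 1) ⁻¹' {k}).indicator (fun _ => (1 : ℝ)) ⟂ᵢ[P] Y (t + 1) k :=
      indep_of_indep_of_le_left
        (hI.indep_comap t (g := fun z => z.2 k) (by fun_prop)) hmeas.comap_le
    have hmul := hind.integral_fun_mul_eq_mul_integral
      (hmeas.mono (F.le t) le_rfl).aestronglyMeasurable
      (hI.payoff_integrable t k).aestronglyMeasurable
    rw [hI.payoff_mean t k, ← integral_mul_const] at hmul
    have hl : ∀ f : Ω → ℝ, (I (t + 1) ⁻¹' {k}).indicator f =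
        fun ω => (I (t + 1) ⁻¹' {k}).indicator (fun _ => (1 : ℝ)) ω * f ω := fun f => by
      ext ω
      by_cases hω : ω ∈ I (t + 1) ⁻¹' {k} <;> simp [hω]
    rw [hl (Y (t + 1) k), hl fun _ => θ k]
    exact hmul
  have h1 : ∀ ω, Y (t + 1) (I (t + 1) ω) ω = _ := hsum (Y (t + 1))
  have h2 : ∀ ω, θ (I (t + 1) ω) = _ := hsum fun k _ => θ k
  simp_rw [h1, h2]
  rw [integral_finsetSum _ fun k _ => (hI.payoff_integrable t k).indicator (hset' k),
    integral_finsetSum _ fun k _ => (integrable_const (θ k)).indicator (hset' k)]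
  exact Finset.sum_congr rfl fun k _ => hterm k

theorem ofReal_regret [IsProbabilityMeasure P] (hI : IsInteraction P S σ θ F X Y I) (T : ℕ) :
    ENNReal.ofReal (regret P θ Y I T) =
      ∫⁻ ω, ∑ t ∈ Finset.Icc 1 T, ENNReal.ofReal (gap θ (I t ω)) ∂P := by
  have hmeas : ∀ (f : Fin K → ℝ), ∀ t ∈ Finset.Icc 1 T, Measurable fun ω => f (I t ω) :=
    fun f t ht => (measurable_of_finite f).comp ((hI.measurable_action (t := t)
      (Finset.mem_Icc.1 ht).1 (by omega)).mono (F.le _) le_rfl)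
  have hint : ∀ (f : Fin K → ℝ), ∀ t ∈ Finset.Icc 1 T, Integrable (fun ω => f (I t ω)) P :=
    fun f t ht => by
      obtain ⟨C, hC⟩ := (Set.finite_range fun i => ‖f i‖).bddAbove
      exact Integrable.of_bound (hmeas f t ht).aestronglyMeasurable C
        (ae_of_all _ fun ω => hC ⟨I t ω, rfl⟩)
  have hreg : regret P θ Y I T = ∑ t ∈ Finset.Icc 1 T, ∫ ω, gap θ (I t ω) ∂P := by
    have h : ∀ t ∈ Finset.Icc 1 T, ∫ ω, gap θ (I t ω) ∂P =
        (⨆ i, θ i) - ∫ ω, Y t (I t ω) ω ∂P := fun t ht => by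
      obtain ⟨s, rfl⟩ := Nat.exists_eq_add_of_le' (Finset.mem_Icc.1 ht).1
      rw [hI.integral_payoff]
      unfold gap
      rw [integral_sub (integrable_const _) (hint θ _ ht)]
      simp
    rw [Finset.sum_congr rfl h, Finset.sum_sub_distrib]
    simp [regret]
  rw [hreg, ENNReal.ofReal_sum_of_nonneg fun t _ => integral_nonneg fun ω => gap_nonneg θ _,
    lintegral_finsetSum _ fun t ht => (hmeas (gap θ) t ht).ennreal_ofReal]
  exact Finset.sum_congr rfl fun t ht => ofReal_integral_eq_lintegral_ofReal (hint (gap θ) t ht)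
    (ae_of_all _ fun ω => gap_nonneg θ _)

end IsInteraction

/-! ### Expected numbers of bad rounds -/

/-- The expected size of a random set of rounds `r + 1` is at most the sum of the probabilities of
events `D r` which occur when `r + 1` belongs to the set. -/
theorem lintegral_card_le (s : Ω → Finset ℕ) (u : Finset ℕ) (D : ℕ → Set Ω)
    (hD : ∀ r ∈ u, MeasurableSet (D r)) (h : ∀ ω, ∀ t ∈ s ω, ∃ r ∈ u, t = r + 1 ∧ ω ∈ D r) :
    ∫⁻ ω, ((s ω).card : ℝ≥0∞) ∂P ≤ ∑ r ∈ u, P (D r) := by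
  classical
  have hle : ∀ ω, ((s ω).card : ℝ≥0∞) ≤ ∑ r ∈ u, (D r).indicator 1 ω := fun ω => by
    have hsub : s ω ⊆ (u.filter fun r => ω ∈ D r).image (· + 1) := fun t ht => by
      obtain ⟨r, hr, rfl, hω⟩ := h ω t ht
      exact Finset.mem_image.2 ⟨r, Finset.mem_filter.2 ⟨hr, hω⟩, rfl⟩
    have hcard := (Finset.card_le_card hsub).trans Finset.card_image_le
    calc ((s ω).card : ℝ≥0∞) ≤ ((u.filter fun r => ω ∈ D r).card : ℝ≥0∞) := by
          exact_mod_cast hcard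
      _ = ∑ r ∈ u, (D r).indicator 1 ω := by
          rw [Finset.card_filter, Nat.cast_sum]
          refine Finset.sum_congr rfl fun r _ => ?_
          by_cases hω : ω ∈ D r <;> simp [hω]
  refine (lintegral_mono hle).trans_eq ?_
  rw [lintegral_finsetSum _ fun r hr => measurable_one.indicator (hD r hr)]
  exact Finset.sum_congr rfl fun r hr => lintegral_indicator_one (hD r hr)

theorem sum_rpow_one_sub_le {α : ℝ} (hα : 2 < α) {T : ℕ} (hT : 1 ≤ T) :
    ∑ r ∈ Finset.Ico 1 T, ((r + 1 : ℕ) : ℝ) ^ (1 - α) ≤ 1 / (α - 2) := by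
  have hT' : (1 : ℝ) ≤ T := by exact_mod_cast hT
  have hanti : AntitoneOn (fun y : ℝ => y ^ (1 - α)) (Set.Icc ((1 : ℕ) : ℝ) T) := by
    intro y hy z _ hyz
    have hy1 : (1 : ℝ) ≤ y := by simpa using hy.1
    exact Real.rpow_le_rpow_of_nonpos (by linarith) hyz (by linarith)
  refine (hanti.sum_le_integral_Ico hT).trans ?_
  rw [Nat.cast_one, integral_rpow (Or.inr ⟨by linarith, by
    rw [Set.uIcc_of_le hT']
    exact fun h => absurd h.1 (by norm_num)⟩)]
  have hpow : (0 : ℝ) ≤ (T : ℝ) ^ (1 - α + 1) := Real.rpow_nonneg (by linarith) _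
  have hneg : (1 - α + 1) = -(α - 2) := by ring
  rw [Real.one_rpow, hneg, div_neg, ← neg_div]
  rw [hneg] at hpow
  exact div_le_div_of_nonneg_right (by linarith) (by linarith)

theorem exists_sign_le {y z : ℝ} (h : y < |z|) : ∃ ρ ∈ ({1, -1} : Finset ℝ), y ≤ ρ * z := by
  rcases lt_abs.1 h with h | h
  · exact ⟨1, by simp, by linarith⟩
  · exact ⟨-1, by simp, by linarith⟩

theorem sq_eq_one_of_mem_signs {ρ : ℝ} (h : ρ ∈ ({1, -1} : Finset ℝ)) : ρ ^ 2 = 1 := by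
  rcases Finset.mem_insert.1 h with rfl | h
  · norm_num
  · rw [Finset.mem_singleton.1 h]
    norm_num

theorem card_signs : ({1, -1} : Finset ℝ).card = 2 :=
  Finset.card_pair (by norm_num)

namespace IsInteraction

/-- The radius of the confidence intervals makes each deviation, for a given number of
observations below `t + 1`, have probability at most `(t + 1) ^ (-α)`. -/
theorem measure_confFails_le [IsProbabilityMeasure P] (hI : IsInteraction P S σ θ F X Y I)
    (hσ : 0 < σ) {α : ℝ} (hα : 0 < α) (t : ℕ) :
    P {ω | ConfFails S σ α θ (fun r => I r ω) (fun r j => X r (I r ω) j ω) (t + 1)} ≤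
      ENNReal.ofReal (2 * K * ((t + 1 : ℕ) : ℝ) ^ (1 - α)) := by
  set L := Real.log ((t + 1 : ℕ) : ℝ)
  have hL : 0 ≤ L := Real.log_natCast_nonneg _
  have ht : (0 : ℝ) < ((t + 1 : ℕ) : ℝ) := by positivity
  have hσ' : (0 : ℝ) < σ := hσ
  let E : Fin K → ℕ → ℝ → Set Ω := fun j n ρ =>
    {ω | (numObs S (fun r => I r ω) j (t + 1) : ℝ) = n ∧
      √(2 * α * (σ : ℝ) ^ 2 * L / n) ≤
        ρ * (empMean S (fun r => I r ω) (fun r j => X r (I r ω) j ω) (t + 1) j - θ j)}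
  have hsub : {ω | ConfFails S σ α θ (fun r => I r ω) (fun r j => X r (I r ω) j ω) (t + 1)} ⊆
      ⋃ j, ⋃ n ∈ Finset.Ico 1 (t + 1), ⋃ ρ ∈ ({1, -1} : Finset ℝ), E j n ρ := by
    rintro ω ⟨j, hn, hdev⟩
    obtain ⟨ρ, hρ, hle⟩ := exists_sign_le hdev
    simp only [Set.mem_iUnion]
    exact ⟨j, _, Finset.mem_Ico.2 ⟨hn, numObs_lt _ _ _ (by omega)⟩, ρ, hρ, rfl, hle⟩
  have hE : ∀ j, ∀ n ∈ Finset.Ico 1 (t + 1), ∀ ρ ∈ ({1, -1} : Finset ℝ),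
      P (E j n ρ) ≤ ENNReal.ofReal (((t + 1 : ℕ) : ℝ) ^ (-α)) := by
    intro j n hn ρ hρ
    have hn0 : (0 : ℝ) < n := by exact_mod_cast (Finset.mem_Ico.1 hn).1
    have hmeas : MeasurableSet[F t] (E j n ρ) :=
      MeasurableSet.inter
        (hI.measurable_numObs (s := t + 1) (t := t) (by omega) j (measurableSet_singleton (n : ℝ)))
        (measurableSet_le measurable_const
          (((hI.measurable_empMean le_rfl j).sub_const _).const_mul ρ))
    have hdev := hI.sum_measure_deviation_le hσ j (m := n) (sq_eq_one_of_mem_signs hρ)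
      (Real.sqrt_nonneg (2 * α * (σ : ℝ) ^ 2 * L / n)) {t} (fun _ => E j n ρ)
      (fun r hr => by rwa [Finset.mem_singleton.1 hr])
      (by simp)
      (fun r hr ω hω => by
        rw [Finset.mem_singleton.1 hr]
        exact hω.1.ge)
      (fun r hr ω hω => by
        rw [Finset.mem_singleton.1 hr]
        exact hω.2)
    rw [Finset.sum_singleton, Real.sq_sqrt (by positivity)] at hdev
    refine hdev.trans_eq ?_
    rw [Real.rpow_def_of_pos ht]
    congr 2
    change _ = L * -α
    field_simp
  calc P {ω | ConfFails S σ α θ (fun r => I r ω) (fun r j => X r (I r ω) j ω) (t + 1)}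
      ≤ ∑ j, P (⋃ n ∈ Finset.Ico 1 (t + 1), ⋃ ρ ∈ ({1, -1} : Finset ℝ), E j n ρ) :=
        (measure_mono hsub).trans (measure_iUnion_fintype_le _ _)
    _ ≤ ∑ j : Fin K, ∑ n ∈ Finset.Ico 1 (t + 1), ∑ ρ ∈ ({1, -1} : Finset ℝ), P (E j n ρ) := by
        refine Finset.sum_le_sum fun j _ => (measure_biUnion_finset_le _ _).trans ?_
        exact Finset.sum_le_sum fun n _ => measure_biUnion_finset_le _ _
    _ ≤ ∑ _j : Fin K, ∑ _n ∈ Finset.Ico 1 (t + 1), ∑ _ρ ∈ ({1, -1} : Finset ℝ),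
          ENNReal.ofReal (((t + 1 : ℕ) : ℝ) ^ (-α)) :=
        Finset.sum_le_sum fun j _ => Finset.sum_le_sum fun n hn => Finset.sum_le_sum fun ρ hρ =>
          hE j n hn ρ hρ
    _ = ENNReal.ofReal (K * (t * (2 * ((t + 1 : ℕ) : ℝ) ^ (-α)))) := by
        simp only [Finset.sum_const, card_signs, Nat.card_Ico, Finset.card_univ, Fintype.card_fin,
          nsmul_eq_mul, Nat.add_sub_cancel]
        rw [ENNReal.ofReal_mul (by positivity), ENNReal.ofReal_mul (by positivity),
          ENNReal.ofReal_mul (by positivity), ENNReal.ofReal_natCast, ENNReal.ofReal_natCast]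
        simp
    _ ≤ ENNReal.ofReal (2 * K * ((t + 1 : ℕ) : ℝ) ^ (1 - α)) := by
        refine ENNReal.ofReal_le_ofReal ?_
        have h1 : ((t + 1 : ℕ) : ℝ) ^ (1 - α) = ((t + 1 : ℕ) : ℝ) * ((t + 1 : ℕ) : ℝ) ^ (-α) := by
          rw [sub_eq_add_neg, Real.rpow_add ht, Real.rpow_one]
        have h2 : (t : ℝ) ≤ ((t + 1 : ℕ) : ℝ) := by push_cast; linarith
        rw [h1]
        calc (K : ℝ) * (t * (2 * ((t + 1 : ℕ) : ℝ) ^ (-α)))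
            ≤ K * (((t + 1 : ℕ) : ℝ) * (2 * ((t + 1 : ℕ) : ℝ) ^ (-α))) := by gcongr
          _ = _ := by ring

open scoped Classical in
theorem lintegral_card_confFails_le [IsProbabilityMeasure P]
    (hI : IsInteraction P S σ θ F X Y I) (hσ : 0 < σ) (hK : 0 < K) {α : ℝ} (hα : 2 < α) {T : ℕ}
    (hT : 1 ≤ T) :
    ∫⁻ ω, (((Finset.range (T + 1)).filter fun t => K < t ∧
        ConfFails S σ α θ (fun r => I r ω) (fun r j => X r (I r ω) j ω) t).card : ℝ≥0∞) ∂P ≤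
      ENNReal.ofReal (2 * K / (α - 2)) := by
  refine (lintegral_card_le _ (Finset.Ico 1 T) (fun r => {ω | ConfFails S σ α θ (fun r => I r ω)
    (fun r j => X r (I r ω) j ω) (r + 1)})
    (fun r _ => F.le r _ (hI.measurableSet_confFails α le_rfl)) fun ω t ht => ?_).trans ?_
  · obtain ⟨htT, hKt, hconf⟩ := Finset.mem_filter.1 ht
    rw [Finset.mem_range] at htT
    obtain ⟨r, rfl⟩ := Nat.exists_eq_add_of_le' (show 1 ≤ t by omega)
    exact ⟨r, Finset.mem_Ico.2 ⟨by omega, by omega⟩, rfl, hconf⟩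
  · refine (Finset.sum_le_sum fun r _ => hI.measure_confFails_le hσ (by linarith) r).trans ?_
    rw [← ENNReal.ofReal_sum_of_nonneg fun r _ => by positivity, ← Finset.mul_sum]
    refine ENNReal.ofReal_le_ofReal ?_
    calc 2 * (K : ℝ) * ∑ r ∈ Finset.Ico 1 T, ((r + 1 : ℕ) : ℝ) ^ (1 - α)
        ≤ 2 * K * (1 / (α - 2)) := by
          gcongr
          exact sum_rpow_one_sub_le hα hT
      _ = 2 * K / (α - 2) := by ring

open scoped Classical in
theorem measurable_card_confFails (hI : IsInteraction P S σ θ F X Y I) (α : ℝ) (T : ℕ) :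
    Measurable fun ω => (((Finset.range (T + 1)).filter fun t => K < t ∧
      ConfFails S σ α θ (fun r => I r ω) (fun r j => X r (I r ω) j ω) t).card : ℝ≥0∞) := by
  simp only [Finset.card_filter, Nat.cast_sum]
  refine Finset.measurable_fun_sum _ fun t _ => ?_
  have hset : MeasurableSet {ω | K < t ∧
      ConfFails S σ α θ (fun r => I r ω) (fun r j => X r (I r ω) j ω) t} :=
    MeasurableSet.inter (.const _) (F.le t _ (hI.measurableSet_confFails α (by omega)))
  exact (measurable_of_countable (fun n : ℕ => (n : ℝ≥0∞))).comp
    (Measurable.ite hset measurable_const measurable_const)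

/-- The exploration rounds are counted by `n_e`. The exploration round with `n_e = s` is a stopping
time, and if it is not forced, then all actions have been observed at least `β(s) / K` times. -/
theorem lintegral_card_inaccurateRounds_le [IsProbabilityMeasure P]
    (hI : IsInteraction P S σ θ F X Y I) (hσ : 0 < σ) (α : ℝ) (β : ℝ≥0 → ℝ≥0) {ε : ℝ}
    (hε : 0 < ε) (T : ℕ) :
    ∫⁻ ω, ((inaccurateRounds S σ α β θ ε (fun r => I r ω)
        (fun r j => X r (I r ω) j ω) T).card : ℝ≥0∞) ∂P ≤
      ENNReal.ofReal (2 * K *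
        ∑ s ∈ Finset.range (T + 1), Real.exp (-(β s * ε ^ 2 / (2 * K * (σ : ℝ) ^ 2)))) := by
  classical
  let A : ℕ → Fin K → ℝ → ℕ → Set Ω := fun s j ρ t =>
    {ω | K < t + 1 ∧ ¬ Exploits S σ α (fun r => I r ω) (fun r j => X r (I r ω) j ω) (t + 1) ∧
      explCount S σ α (fun r => I r ω) (fun r j => X r (I r ω) j ω) (t + 1) = s ∧
      (β s : ℝ) / K ≤ (numObs S (fun r => I r ω) j (t + 1) : ℝ) ∧
      ε ≤ ρ * (empMean S (fun r => I r ω) (fun r j => X r (I r ω) j ω) (t + 1) j - θ j)}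
  have hA : ∀ s j ρ t, MeasurableSet[F t] (A s j ρ t) := fun s j ρ t =>
    MeasurableSet.inter (.const _) <|
      (hI.measurableSet_exploits α le_rfl).compl.inter <|
      (hI.measurable_explCount α le_rfl (measurableSet_singleton s)).inter <|
      (measurableSet_le measurable_const (hI.measurable_numObs (by omega) j)).inter <|
      measurableSet_le measurable_const
        (((hI.measurable_empMean le_rfl j).sub_const _).const_mul ρ)
  have hsum : ∀ s j, ∀ ρ ∈ ({1, -1} : Finset ℝ), ∑ t ∈ Finset.range T, P (A s j ρ t) ≤
      ENNReal.ofReal (Real.exp (-(β s * ε ^ 2 / (2 * K * (σ : ℝ) ^ 2)))) := by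
    intro s j ρ hρ
    have hdisj : ∀ t u, t < u → Disjoint (A s j ρ t) (A s j ρ u) := fun t u htu => by
      rw [Set.disjoint_left]
      rintro ω ⟨hK, hex, hs, -⟩ ⟨-, -, hs', -⟩
      have h1 := explCount_succ_of_not_exploits hK hex
      have h2 := explCount_mono S σ α (fun r => I r ω) (fun r j => X r (I r ω) j ω)
        (show t + 1 + 1 ≤ u + 1 by omega)
      omega
    refine (hI.sum_measure_deviation_le hσ j (sq_eq_one_of_mem_signs hρ) hε.le (Finset.range T)
      (A s j ρ) (fun t _ => hA s j ρ t) (fun t _ u _ htu => ?_)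
      (fun t _ ω hω => hω.2.2.2.1) (fun t _ ω hω => hω.2.2.2.2)).trans_eq ?_
    · rcases lt_or_gt_of_ne htu with h | h
      · exact hdisj t u h
      · exact (hdisj u t h).symm
    · congr 3
      field_simp
  refine (lintegral_card_le _ (Finset.range T) (fun t => ⋃ s ∈ Finset.range (T + 1), ⋃ j,
    ⋃ ρ ∈ ({1, -1} : Finset ℝ), A s j ρ t) (fun t _ => ?_) fun ω t ht => ?_).trans ?_
  · exact Finset.measurableSet_biUnion _ fun s _ => .iUnion fun j =>
      Finset.measurableSet_biUnion _ fun ρ _ => F.le t _ (hA s j ρ t)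
  · obtain ⟨htT, hKt, hex, hf, j, hdev⟩ := Finset.mem_filter.1 ht
    rw [Finset.mem_range] at htT
    obtain ⟨r, rfl⟩ := Nat.exists_eq_add_of_le' (show 1 ≤ t by omega)
    obtain ⟨ρ, hρ, hle⟩ := exists_sign_le hdev
    refine ⟨r, Finset.mem_range.2 (by omega), rfl, ?_⟩
    simp only [Set.mem_iUnion]
    refine ⟨explCount S σ α (fun r => I r ω) (fun r j => X r (I r ω) j ω) (r + 1),
      Finset.mem_range.2 ((explCount_le _ _ _ _ _ _).trans_lt htT), j, ρ, hρ, hKt, hex, rfl,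
      (not_lt.1 hf).trans ?_, hle⟩
    exact_mod_cast ciInf_le (OrderBot.bddBelow _) j
  · calc ∑ t ∈ Finset.range T, P (⋃ s ∈ Finset.range (T + 1), ⋃ j,
          ⋃ ρ ∈ ({1, -1} : Finset ℝ), A s j ρ t)
        ≤ ∑ t ∈ Finset.range T, ∑ s ∈ Finset.range (T + 1), ∑ j,
          ∑ ρ ∈ ({1, -1} : Finset ℝ), P (A s j ρ t) := by
          refine Finset.sum_le_sum fun t _ => (measure_biUnion_finset_le _ _).trans ?_
          refine Finset.sum_le_sum fun s _ => (measure_iUnion_fintype_le _ _).trans ?_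
          exact Finset.sum_le_sum fun j _ => measure_biUnion_finset_le _ _
      _ = ∑ s ∈ Finset.range (T + 1), ∑ j, ∑ ρ ∈ ({1, -1} : Finset ℝ),
          ∑ t ∈ Finset.range T, P (A s j ρ t) := by
          rw [Finset.sum_comm]
          refine Finset.sum_congr rfl fun s _ => ?_
          rw [Finset.sum_comm]
          exact Finset.sum_congr rfl fun j _ => Finset.sum_comm
      _ ≤ ∑ s ∈ Finset.range (T + 1), ∑ _j : Fin K, ∑ _ρ ∈ ({1, -1} : Finset ℝ),
          ENNReal.ofReal (Real.exp (-(β s * ε ^ 2 / (2 * K * (σ : ℝ) ^ 2)))) :=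
          Finset.sum_le_sum fun s _ => Finset.sum_le_sum fun j _ => Finset.sum_le_sum fun ρ hρ =>
            hsum s j ρ hρ
      _ = _ := by
          rw [ENNReal.ofReal_mul (by positivity),
            ENNReal.ofReal_sum_of_nonneg fun s _ => (Real.exp_pos _).le, Finset.mul_sum]
          refine Finset.sum_congr rfl fun s _ => ?_
          simp only [Finset.sum_const, card_signs, Finset.card_univ, Fintype.card_fin,
            nsmul_eq_mul]
          rw [ENNReal.ofReal_mul (by positivity), ENNReal.ofReal_natCast]
          simp only [ENNReal.ofReal_ofNat, Nat.cast_ofNat]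
          ring

end IsInteraction

end GraphBandit

theorem mainTheorem4 {K : ℕ} {Ω : Type*} [mΩ : MeasurableSpace Ω]
    (P : Measure Ω) [IsProbabilityMeasure P]
    (S : Fin K → Finset (Fin K)) (hS : ∀ j, ∃ i, j ∈ S i)
    (σ : ℝ≥0) (hσ : 0 < σ)
    (D : ℝ) (θ : Fin K → ℝ) (hθ : ∀ i, θ i ∈ Set.Icc 0 D)
    (ε : ℝ) (hε : 0 < ε) (α : ℝ) (hα : 2 < α)
    (β : ℝ≥0 → ℝ≥0) (hβ_mono : Monotone β)
    (hβ_half : ∀ n : ℕ, β n ≤ n / 2)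
    (hβ_sub : ∀ m n : ℕ, β (m + n) ≤ β m + β n)
    (c : (Fin K → ℝ) → (Fin K → ℝ)) (hc : GraphBandit.IsLPSelection S σ c)
    (F : Filtration ℕ mΩ)
    (X : ℕ → Fin K → Fin K → Ω → ℝ) (Y : ℕ → Fin K → Ω → ℝ) (I : ℕ → Ω → Fin K)
    (hI : GraphBandit.IsInteraction P S σ θ F X Y I)
    (halg : ∀ᵐ ω ∂P, GraphBandit.FollowsAlgorithm S σ α β c
      (fun t => I t ω) (fun t j => X t (I t ω) j ω))
    (T : ℕ) (hT : 1 ≤ T) :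
    ENNReal.ofReal (GraphBandit.regret P θ Y I T) ≤
      ENNReal.ofReal ((2 * K + 2 + 4 * K / (α - 2)) * GraphBandit.maxGap θ)
      + ENNReal.ofReal (4 * K * GraphBandit.maxGap θ *
          ∑ s ∈ Finset.range (T + 1), Real.exp (-(β s * ε ^ 2 / (2 * K * (σ : ℝ) ^ 2))))
      + ENNReal.ofReal (2 * GraphBandit.maxGap θ) *
          GraphBandit.extend β
            (ENNReal.ofReal (4 * α * Real.log T) * ∑ i, GraphBandit.cSup c θ ε i + K)
      + ENNReal.ofReal (4 * α * Real.log T) *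
          ∑ i, GraphBandit.cSup c θ ε i * ENNReal.ofReal (GraphBandit.gap θ i) := by
  classical
  obtain ⟨ω₀⟩ := nonempty_of_isProbabilityMeasure P
  have hK : 0 < K := Fin.pos (I 0 ω₀)
  have hα0 : 0 < α := by linarith
  set d := GraphBandit.maxGap θ
  have hd : 0 ≤ d := GraphBandit.maxGap_nonneg θ
  set E := ∑ s ∈ Finset.range (T + 1), Real.exp (-(β s * ε ^ 2 / (2 * K * (σ : ℝ) ^ 2)))
  have hE : 0 ≤ E := Finset.sum_nonneg fun s _ => (Real.exp_pos _).le
  set e := GraphBandit.extend β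
    (ENNReal.ofReal (4 * α * Real.log T) * ∑ i, GraphBandit.cSup c θ ε i + K)
  set g := ENNReal.ofReal (4 * α * Real.log T) *
    ∑ i, GraphBandit.cSup c θ ε i * ENNReal.ofReal (GraphBandit.gap θ i)
  let U : Ω → ℝ≥0∞ := fun ω => (((Finset.range (T + 1)).filter fun t => K < t ∧
    GraphBandit.ConfFails S σ α θ (fun r => I r ω) (fun r j => X r (I r ω) j ω) t).card : ℝ≥0∞)
  let A : Ω → ℝ≥0∞ := fun ω => ((GraphBandit.inaccurateRounds S σ α β θ ε (fun r => I r ω)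
    (fun r j => X r (I r ω) j ω) T).card : ℝ≥0∞)
  have hU : Measurable U := hI.measurable_card_confFails α T
  have hUle : ∫⁻ ω, U ω ∂P ≤ ENNReal.ofReal (2 * K / (α - 2)) :=
    hI.lintegral_card_confFails_le hσ hK hα hT
  have hAle : ∫⁻ ω, A ω ∂P ≤ ENNReal.ofReal (2 * K * E) :=
    hI.lintegral_card_inaccurateRounds_le hσ α β hε T
  have hα2 : 0 ≤ 2 * (K : ℝ) / (α - 2) := div_nonneg (by positivity) (by linarith)
  calc ENNReal.ofReal (GraphBandit.regret P θ Y I T)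
      = ∫⁻ ω, ∑ t ∈ Finset.Icc 1 T, ENNReal.ofReal (GraphBandit.gap θ (I t ω)) ∂P :=
        hI.ofReal_regret T
    _ ≤ ∫⁻ ω, (ENNReal.ofReal d * ((2 * K + U ω) + 2 * A ω) +
          (2 * ENNReal.ofReal d * e + g)) ∂P := by
        refine lintegral_mono_ae ?_
        filter_upwards [halg, hI.ae_exists_isUniqueBest hσ] with ω hω huniq
        rw [← add_assoc]
        exact GraphBandit.sum_gap_le hα0 hβ_mono hβ_half hβ_sub hω
          fun t ht _ => huniq t (hω.numObs_pos ht)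
    _ = ENNReal.ofReal d * ((2 * K + ∫⁻ ω, U ω ∂P) + 2 * ∫⁻ ω, A ω ∂P) +
          (2 * ENNReal.ofReal d * e + g) := by
        have hUc : Measurable fun ω => 2 * (K : ℝ≥0∞) + U ω := measurable_const.add hU
        rw [lintegral_add_right _ measurable_const, lintegral_const_mul' _ _ ENNReal.ofReal_ne_top,
          lintegral_add_left hUc, lintegral_add_left measurable_const,
          lintegral_const_mul' 2 A (by simp), lintegral_const, lintegral_const, measure_univ,
          mul_one, mul_one]
    _ ≤ ENNReal.ofReal d * ((2 * K + ENNReal.ofReal (2 * K / (α - 2))) +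
          2 * ENNReal.ofReal (2 * K * E)) + (2 * ENNReal.ofReal d * e + g) := by
        gcongr
    _ = ENNReal.ofReal ((2 * K + 2 * K / (α - 2)) * d) + ENNReal.ofReal (4 * K * d * E) +
          ENNReal.ofReal (2 * d) * e + g := by
        have h2K : (2 * K : ℝ≥0∞) = ENNReal.ofReal (2 * K) := by
          rw [ENNReal.ofReal_mul (by norm_num), ENNReal.ofReal_natCast, ENNReal.ofReal_ofNat]
        have h2 : ENNReal.ofReal (2 * d) = 2 * ENNReal.ofReal d := by
          rw [ENNReal.ofReal_mul (by norm_num), ENNReal.ofReal_ofNat]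
        have h4 : (2 : ℝ≥0∞) * ENNReal.ofReal (2 * K * E) = ENNReal.ofReal (4 * K * E) := by
          rw [← ENNReal.ofReal_ofNat, ← ENNReal.ofReal_mul (by norm_num)]
          ring_nf
        rw [h2K, h2, h4, mul_add, ← ENNReal.ofReal_add (by positivity) hα2,
          ← ENNReal.ofReal_mul hd, ← ENNReal.ofReal_mul hd, mul_comm d, mul_left_comm d,
          ← add_assoc]
        ring_nf
    _ ≤ _ := by
        -- Only the constant term differs: `2 K / (α - 2)` is half of what the claim allows.
        refine add_le_add_left (add_le_add_left (add_le_add_left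
          (ENNReal.ofReal_le_ofReal (mul_le_mul_of_nonneg_right ?_ hd)) _) _) _
        have hKα : 4 * (K : ℝ) / (α - 2) = 2 * (2 * K / (α - 2)) := by ring
        linarith
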